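/- Let $A_1=(0,0)$, $A_2=(1,0)$, $A_3=(1/2,\sqrt3/2)$ be points of the plane $\mathbb{R}^2=\mathbb{C}$, and let $p_1,p_2,p_3>0$ with $p_1+p_2+p_3<1$. For $k=1,2,3$ let $S_k(z)=p_kz-p_kA_k+A_k$ be the similarity with ratio $p_k$ and fixed point $A_k$, write $S_{jk}=S_j\circ S_k$, and let $K'$ be the attractor of $\{S_1,S_2,S_3\}$. (The attractor of a finite system of contractions $\{S_i\}$ is the nonempty compact set $K$ with $K=\bigcup_iS_i(K)$.) Let $B_1,B_2,B_3$ be the vertices of an equilateral triangle with $$B_1\in K'\cap S_{12}([A_2,A_3]),\quad B_2\in K'\cap S_{23}([A_1,A_3]),\quad B_3\in K'\cap S_{31}([A_1,A_2]),$$ let $S_0$ be the similarity of the plane with $S_0(A_k)=B_k$ for $k=1,2,3$, let $O$ be its fixed point, and let $K$ be the attractor of $\mathcal S=\{S_0,S_1,S_2,S_3\}$. Then for each $k=1,2,3$ there is exactly one arc $\gamma_k\subset K$ with endpoints $O$ and $A_k$; the three arcs have the same Hausdorff dimension $s=\dim_H\gamma_1=\dim_H\gamma_2=\dim_H\gamma_3$;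 and the set $CP(K)$ of cut points of $K$ (the points $x\in K$ for which $K\setminus\{x\}$ is disconnected) satisfies $$\dim_H CP(K)=s.$$ Moreover, $\dim_H K'\le 1$, and $CP(K)\subset G_{\mathcal S}(\gamma_1\cup\gamma_2\cup\gamma_3\cup K')$, where $G_{\mathcal S}(X)$ denotes the union of the sets $S_{j_1}\circ\cdots\circ S_{j_n}(X)$ over all $n\ge1$ and $j_1,\dots,j_n\in\{0,1,2,3\}$. -/

import Mathlib

open scoped ENNReal

/-- The vertices `A₁ = (0,0)`, `A₂ = (1,0)`, `A₃ = (1/2, √3/2)` of the triangle, in the plane `ℂ`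
(indexed by `0, 1, 2`). -/
noncomputable def triVertex : Fin 3 → ℂ := ![0, 1, ⟨1 / 2, Real.sqrt 3 / 2⟩]

/-- The similarity with ratio `p k` and fixed point at the `k`-th vertex:
`S₁ z = p₁ z`, `S₂ z = p₂ z - p₂ + 1`, `S₃ z = p₃ z - p₃ e^{iπ/3} + e^{iπ/3}`. -/
noncomputable def cornerMap (p : Fin 3 → ℝ) (k : Fin 3) (z : ℂ) : ℂ :=
  (p k : ℂ) * z - (p k : ℂ) * triVertex k + triVertex k

/-- The system `{S₀, S₁, S₂, S₃}`. -/
noncomputable def dendriteSystem (p : Fin 3 → ℝ) (S₀ : ℂ → ℂ) : Fin 4 → ℂ → ℂ :=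
  ![S₀, cornerMap p 0, cornerMap p 1, cornerMap p 2]

/-- `K` is an attractor of the system `S`: nonempty, compact and equal to `⋃ i, S i (K)`. -/
def IsAttractor {ι : Type*} (S : ι → ℂ → ℂ) (K : Set ℂ) : Prop :=
  K.Nonempty ∧ IsCompact K ∧ K = ⋃ i, S i '' K

/-- `S_j = S_{j₁} ∘ S_{j₂} ∘ ⋯ ∘ S_{jₙ}` for a word `j = j₁ j₂ … jₙ`. -/
def wordMap {ι : Type*} (S : ι → ℂ → ℂ) : List ι → ℂ → ℂ
  | [] => id
  | i :: w => S i ∘ wordMap S w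

/-- The orbit `G_S(X)` of a set `X` under the semigroup `{S_j : j a nonempty word}`. -/
def semigroupOrbit {ι : Type*} (S : ι → ℂ → ℂ) (X : Set ℂ) : Set ℂ :=
  ⋃ w ∈ {w : List ι | w ≠ []}, wordMap S w '' X

/-- `γ` is an arc with endpoints `x` and `y` (a homeomorphic image of `[0,1]`) contained in `K`. -/
def IsArcIn (K : Set ℂ) (x y : ℂ) (γ : Set ℂ) : Prop :=
  γ ⊆ K ∧ ∃ f : ℝ → ℂ, ContinuousOn f (Set.Icc 0 1) ∧ Set.InjOn f (Set.Icc 0 1) ∧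
    f 0 = x ∧ f 1 = y ∧ f '' Set.Icc 0 1 = γ

/-- The set of cut points of `K`: the points of `K` whose removal disconnects `K`. -/
def cutPoints (K : Set ℂ) : Set ℂ := {x ∈ K | ¬ IsPreconnected (K \ {x})}

/-!
The set `K` is a dendrite, and the proof works with its tree-like gluing only. The barycentric
coordinates show that the central piece `S₀ K` meets the outer piece `S k K` exactly in
`B k = S₀ (A k) = S k (C k)` and that the outer pieces are disjoint; moreover `C k` belongs to
`S (k + 1) K'`. These facts are collected in `StarSystem`, and everything except the bound
`dimH K' ≤ 1` (`IsAttractor.dimH_le_one`) is derived from them. Most estimates are instances of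
`nonpos_of_forall_le_mul`: a bounded quantity bounded by `ρ < 1` times another value of the same
quantity is nonpositive.

*Arcs.* To go from `a` to `b` in `K'` inside `K`, one stays in the outer piece containing both, or
else goes to the gluing point of the first piece, crosses the central piece between two vertices,
and enters the last piece at its gluing point. After rescaling, each of the parts joins again two
points of `K'`, since `K'` contains the vertices and the points `C k`. So the paths are the fixed
point of a contraction (`StarSystem.step`). With a parametrization that spends no time on constant
parts they are injective (`IsArcFamily.injOn`).

*Minimality.* A subcontinuum of `K` with points in two pieces contains the gluing point, and its
intersection with a piece is connected. By the same recursion, every subcontinuum containing `a` and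
`b` contains the path between them (`IsArcFamily.mem_subcontinuum`). The path from `A i` to `A j` is
mapped into itself by `S₀`, so it contains `O`; its part from `A i` to `O` is the smallest
subcontinuum containing these two points, hence the only arc between them.

*Dimensions.* As `C i` lies in the piece `i + 1`, the branch to `A i` crosses `S i S₀ K` from the
`i`-th to the `(i + 1)`-st vertex of this piece, so it contains a copy of the branch to `A (i + 1)`
(`IsArcFamily.image_hull_subset`). Going around, the three dimensions agree.

*Cut points.* If `x` is an interior point of a path from `a` to `b` and `K \ {x}` were connected,
the local connectedness of `K` would give a subcontinuum containing `a` and `b` but not `x`, against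
minimality; so the branches, up to an endpoint, consist of cut points. Conversely, the union of the
paths between points of `K'` is a connected set containing `K'`, and it is contained in the orbit of
`K'` and the branches. If `x` is outside this orbit, replacing the small pieces around `x` by copies
of that union leaves connected sets avoiding `x` which exhaust `K \ {x}`
(`IsArcFamily.cutPoints_subset`). The branches have dimension at least `1`, so `K'` does not
contribute to the dimension of the orbit.
-/

open Set Filter Topology

/-- A self-improving estimate: a bounded function, each value of which is at most `ρ < 1` times
another value, is nonpositive. -/
lemma nonpos_of_forall_le_mul {Y : Type*} {ρ M : ℝ} (hρ : 0 ≤ ρ) (hρ1 : ρ < 1) (f : Y → ℝ)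
    (hM : ∀ y, f y ≤ M) (h : ∀ y, ∃ y', f y ≤ ρ * f y') (y : Y) : f y ≤ 0 := by
  have key : ∀ n : ℕ, ∀ y, f y ≤ ρ ^ n * M := by
    intro n
    induction n with
    | zero => simpa using hM
    | succ n ih =>
      intro y
      obtain ⟨y', hy'⟩ := h y
      calc f y ≤ ρ * f y' := hy'
        _ ≤ ρ * (ρ ^ n * M) := mul_le_mul_of_nonneg_left (ih y') hρ
        _ = ρ ^ (n + 1) * M := by ring
  have hlim : Tendsto (fun n : ℕ => ρ ^ n * M) atTop (𝓝 (0 * M)) :=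
    (tendsto_pow_atTop_nhds_zero_of_lt_one hρ hρ1).mul_const M
  rw [zero_mul] at hlim
  exact ge_of_tendsto' hlim fun n => key n y

/-! ### Connected subsets of a union of two closed sets sharing at most one point -/

lemma IsPreconnected.mem_of_inter_subset_singleton {α : Type*} [TopologicalSpace α]
    {D P Q : Set α} {c : α} (hD : IsPreconnected D) (hP : IsClosed P) (hQ : IsClosed Q)
    (hDPQ : D ⊆ P ∪ Q) (hPQ : P ∩ Q ⊆ {c}) (hDP : (D ∩ P).Nonempty) (hDQ : (D ∩ Q).Nonempty) :
    c ∈ D := by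
  obtain ⟨y, hyD, hy⟩ := isPreconnected_closed_iff.1 hD P Q hP hQ hDPQ hDP hDQ
  exact hPQ hy ▸ hyD

lemma IsPreconnected.inter_of_inter_subset_singleton {α : Type*} [TopologicalSpace α]
    {D P Q : Set α} {c : α} (hD : IsPreconnected D) (hP : IsClosed P) (hQ : IsClosed Q)
    (hDPQ : D ⊆ P ∪ Q) (hPQ : P ∩ Q ⊆ {c}) : IsPreconnected (D ∩ P) := by
  rw [isPreconnected_closed_iff] at hD ⊢
  -- Given a closed cover `u`, `v` of `D ∩ P`, the set `Q` is added to the member containing `c`.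
  have key : ∀ u v : Set α, IsClosed u → IsClosed v → D ∩ P ⊆ u ∪ v → (D ∩ P ∩ u).Nonempty →
      (D ∩ P ∩ v).Nonempty → (c ∈ u ∨ c ∉ v) → (D ∩ P ∩ (u ∩ v)).Nonempty := by
    rintro u v hu hv huv ⟨x, ⟨hxD, hxP⟩, hxu⟩ ⟨y, ⟨hyD, hyP⟩, hyv⟩ hc
    obtain ⟨z, hzD, hzu | hzQ, hzP, hzv⟩ := hD (P ∩ u ∪ Q) (P ∩ v) ((hP.inter hu).union hQ)
      (hP.inter hv) (fun w hw => by
        rcases hDPQ hw with h | h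
        · rcases huv ⟨hw, h⟩ with h' | h'
          · exact Or.inl (Or.inl ⟨h, h'⟩)
          · exact Or.inr ⟨h, h'⟩
        · exact Or.inl (Or.inr h)) ⟨x, hxD, Or.inl ⟨hxP, hxu⟩⟩ ⟨y, hyD, hyP, hyv⟩
    · exact ⟨z, ⟨hzD, hzP⟩, hzu.2, hzv⟩
    · obtain rfl : z = c := hPQ ⟨hzP, hzQ⟩
      exact ⟨z, ⟨hzD, hzP⟩, hc.resolve_right fun h => h hzv, hzv⟩
  intro u v hu hv huv hnu hnv
  by_cases hc : c ∈ u
  · exact key u v hu hv huv hnu hnv (Or.inl hc)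
  · rw [inter_comm u v]
    exact key v u hv hu (by rwa [union_comm]) hnv hnu (Or.inr hc)

/-! ### Similarities -/

/-- `f` is a similarity of the plane whose ratio lies in `(0, ρ]`. -/
def IsSimilarityLE (ρ : ℝ) (f : ℂ → ℂ) : Prop :=
  ∃ r, 0 < r ∧ r ≤ ρ ∧ ∀ x y, dist (f x) (f y) = r * dist x y

namespace IsSimilarityLE

variable {ρ : ℝ} {f : ℂ → ℂ}

lemma pos (hf : IsSimilarityLE ρ f) : 0 < ρ := by
  obtain ⟨r, h0, h1, -⟩ := hf
  exact h0.trans_le h1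

lemma dist_le (hf : IsSimilarityLE ρ f) (x y : ℂ) : dist (f x) (f y) ≤ ρ * dist x y := by
  obtain ⟨r, -, h1, h⟩ := hf
  rw [h]
  exact mul_le_mul_of_nonneg_right h1 dist_nonneg

lemma injective (hf : IsSimilarityLE ρ f) : Function.Injective f := by
  obtain ⟨r, h0, -, h⟩ := hf
  intro x y hxy
  have := h x y
  rw [hxy, dist_self] at this
  exact dist_eq_zero.1 ((mul_eq_zero.1 this.symm).resolve_left h0.ne')

lemma lipschitzWith (hf : IsSimilarityLE ρ f) : LipschitzWith ρ.toNNReal f :=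
  LipschitzWith.of_dist_le_mul fun x y => by
    rw [Real.coe_toNNReal _ hf.pos.le]
    exact hf.dist_le x y

lemma continuous (hf : IsSimilarityLE ρ f) : Continuous f := hf.lipschitzWith.continuous

lemma exists_antilipschitzWith (hf : IsSimilarityLE ρ f) : ∃ c, AntilipschitzWith c f := by
  obtain ⟨r, h0, -, h⟩ := hf
  refine ⟨r⁻¹.toNNReal, AntilipschitzWith.of_le_mul_dist fun x y => ?_⟩
  rw [h, Real.coe_toNNReal _ (inv_nonneg.2 h0.le), inv_mul_cancel_left₀ h0.ne']

lemma isInducing (hf : IsSimilarityLE ρ f) : IsInducing f := by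
  obtain ⟨c, hc⟩ := hf.exists_antilipschitzWith
  exact (hc.isUniformInducing hf.lipschitzWith.uniformContinuous).isInducing

lemma le_dimH_of_image_subset (hf : IsSimilarityLE ρ f) {s t : Set ℂ} (h : f '' s ⊆ t) :
    dimH s ≤ dimH t := by
  obtain ⟨c, hc⟩ := hf.exists_antilipschitzWith
  exact (hc.le_dimH_image s).trans (dimH_mono h)

lemma infDist_le (hf : IsSimilarityLE ρ f) {s t : Set ℂ} (hs : s.Nonempty)
    (h : ∀ y ∈ s, f y ∈ t) (x : ℂ) :
    Metric.infDist (f x) t ≤ ρ * Metric.infDist x s := by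
  have : Metric.infDist (f x) t / ρ ≤ Metric.infDist x s := by
    rw [Metric.le_infDist hs]
    intro y hy
    rw [div_le_iff₀ hf.pos, mul_comm]
    exact (Metric.infDist_le_dist_of_mem (h y hy)).trans (hf.dist_le x y)
  rwa [div_le_iff₀ hf.pos, mul_comm] at this

/-- A nonempty closed set mapped into itself by a contracting similarity contains its fixed
point. -/
lemma mem_of_fixed (hf : IsSimilarityLE ρ f) (hρ : ρ < 1) {s : Set ℂ} (hs : IsClosed s)
    (hne : s.Nonempty) (h : ∀ y ∈ s, f y ∈ s) {x : ℂ} (hx : f x = x) : x ∈ s := by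
  have h1 := hf.infDist_le hne h x
  rw [hx] at h1
  rw [hs.mem_iff_infDist_zero hne]
  nlinarith [Metric.infDist_nonneg (x := x) (s := s)]

end IsSimilarityLE

/-! ### Star systems -/

/-- The combinatorial core of the situation: a compact set `K` made of a central piece `S₀ K` and
three pairwise disjoint outer pieces `S k K`, the central piece meeting the `k`-th outer one only in
`S₀ (A k) = S k (C k)`, where `A k` is the fixed point of `S k`. The gluing points `C k` are taken
in the part `S (k + 1) K'` of the attractor `K'` of the outer maps. -/
structure StarSystem (S₀ : ℂ → ℂ) (S : Fin 3 → ℂ → ℂ) (A C : Fin 3 → ℂ) (K K' : Set ℂ)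
    (ρ : ℝ) : Prop where
  lt_one : ρ < 1
  sim₀ : IsSimilarityLE ρ S₀
  sim : ∀ k, IsSimilarityLE ρ (S k)
  isCompact : IsCompact K
  eq_union : K = S₀ '' K ∪ ⋃ k, S k '' K
  isCompact' : IsCompact K'
  eq_union' : K' = ⋃ k, S k '' K'
  subset : K' ⊆ K
  A_mem : ∀ k, A k ∈ K'
  A_fixed : ∀ k, S k (A k) = A k
  C_mem : ∀ k, C k ∈ S (k + 1) '' K'
  glue : ∀ k, S₀ (A k) = S k (C k)
  center_inter : ∀ k, S₀ '' K ∩ S k '' K ⊆ {S₀ (A k)}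
  disj : ∀ i j, i ≠ j → Disjoint (S i '' K) (S j '' K)

/-- A subcontinuum of `K` (possibly empty): a closed connected subset. -/
structure IsSubcontinuum (K D : Set ℂ) : Prop where
  subset : D ⊆ K
  isClosed : IsClosed D
  isPreconnected : IsPreconnected D

namespace StarSystem

variable {S₀ : ℂ → ℂ} {S : Fin 3 → ℂ → ℂ} {A C : Fin 3 → ℂ} {K K' : Set ℂ} {ρ : ℝ}

lemma pos (h : StarSystem S₀ S A C K K' ρ) : 0 < ρ := h.sim₀.pos

lemma exists_pow_mul_lt (h : StarSystem S₀ S A C K K' ρ) (M : ℝ) {ε : ℝ} (hε : 0 < ε) :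
    ∃ n : ℕ, ρ ^ n * M < ε := by
  have hlim : Tendsto (fun n : ℕ => ρ ^ n * M) atTop (𝓝 (0 * M)) :=
    (tendsto_pow_atTop_nhds_zero_of_lt_one h.pos.le h.lt_one).mul_const M
  rw [zero_mul] at hlim
  exact (hlim.eventually (gt_mem_nhds hε)).exists

lemma map₀_mem (h : StarSystem S₀ S A C K K' ρ) {x : ℂ} (hx : x ∈ K) : S₀ x ∈ K := by
  rw [h.eq_union]
  exact Or.inl ⟨x, hx, rfl⟩

lemma map_mem (h : StarSystem S₀ S A C K K' ρ) (k : Fin 3) {x : ℂ} (hx : x ∈ K) : S k x ∈ K := by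
  rw [h.eq_union]
  exact Or.inr (mem_iUnion.2 ⟨k, x, hx, rfl⟩)

lemma map_mem' (h : StarSystem S₀ S A C K K' ρ) (k : Fin 3) {x : ℂ} (hx : x ∈ K') :
    S k x ∈ K' := by
  rw [h.eq_union']
  exact mem_iUnion.2 ⟨k, x, hx, rfl⟩

lemma C_mem' (h : StarSystem S₀ S A C K K' ρ) (k : Fin 3) : C k ∈ K' := by
  obtain ⟨x, hx, hxC⟩ := h.C_mem k
  exact hxC ▸ h.map_mem' _ hx

lemma eq_of_map_eq (h : StarSystem S₀ S A C K K' ρ) {i j : Fin 3} {x y : ℂ} (hx : x ∈ K)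
    (hy : y ∈ K) (hxy : S i x = S j y) : i = j := by
  by_contra hij
  exact Set.disjoint_left.1 (h.disj i j hij) ⟨x, hx, rfl⟩ ⟨y, hy, hxy.symm⟩

lemma eq_of_map₀_eq (h : StarSystem S₀ S A C K K' ρ) {j : Fin 3} {x y : ℂ} (hx : x ∈ K)
    (hy : y ∈ K) (hxy : S₀ x = S j y) : x = A j ∧ y = C j := by
  have h1 : S₀ x = S₀ (A j) := h.center_inter j ⟨⟨x, hx, rfl⟩, ⟨y, hy, hxy.symm⟩⟩
  refine ⟨h.sim₀.injective h1, (h.sim j).injective ?_⟩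
  rw [← hxy, h1, h.glue]

lemma A_ne_C (h : StarSystem S₀ S A C K K' ρ) (i : Fin 3) : A i ≠ C i := by
  intro hAC
  obtain ⟨x, hx, hxC⟩ := h.C_mem i
  have := h.eq_of_map_eq (h.subset (h.A_mem i)) (h.subset hx)
    ((h.A_fixed i).trans (hAC.trans hxC.symm))
  exact (by decide : ∀ i : Fin 3, i ≠ i + 1) i this

lemma A_injective (h : StarSystem S₀ S A C K K' ρ) : Function.Injective A := by
  intro i j hij
  refine h.eq_of_map_eq (h.subset (h.A_mem i)) (h.subset (h.A_mem j)) ?_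
  rw [h.A_fixed, h.A_fixed, hij]

lemma cases (h : StarSystem S₀ S A C K K' ρ) {x : ℂ} (hx : x ∈ K) :
    (∃ y ∈ K, S₀ y = x) ∨ ∃ k, ∃ y ∈ K, S k y = x := by
  rw [h.eq_union] at hx
  rcases hx with hx | hx
  · exact Or.inl hx
  · exact Or.inr (mem_iUnion.1 hx)

/-- The union of the pieces of `K` other than `S k K`. -/
def rest (S₀ : ℂ → ℂ) (S : Fin 3 → ℂ → ℂ) (K : Set ℂ) (k : Fin 3) : Set ℂ :=
  S₀ '' K ∪ ⋃ j ∈ {j : Fin 3 | j ≠ k}, S j '' K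

lemma isClosed_image (h : StarSystem S₀ S A C K K' ρ) (k : Fin 3) : IsClosed (S k '' K) :=
  (h.isCompact.image (h.sim k).continuous).isClosed

lemma isClosed_rest (h : StarSystem S₀ S A C K K' ρ) (k : Fin 3) : IsClosed (rest S₀ S K k) :=
  (h.isCompact.image h.sim₀.continuous).isClosed.union
    (Set.Finite.isClosed_biUnion (Set.toFinite _) fun j _ => h.isClosed_image j)

lemma subset_image_union_rest (h : StarSystem S₀ S A C K K' ρ) (k : Fin 3) :
    K ⊆ S k '' K ∪ rest S₀ S K k := by
  intro x hx
  rcases h.cases hx with hx | ⟨j, hx⟩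
  · exact Or.inr (Or.inl hx)
  · by_cases hj : j = k
    · exact Or.inl (hj ▸ hx)
    · exact Or.inr (Or.inr (mem_biUnion (show j ∈ {j : Fin 3 | j ≠ k} from hj) hx))

lemma image_inter_rest (h : StarSystem S₀ S A C K K' ρ) (k : Fin 3) :
    S k '' K ∩ rest S₀ S K k ⊆ {S₀ (A k)} := by
  rintro x ⟨hx, hx0 | hx1⟩
  · exact h.center_inter k ⟨hx0, hx⟩
  · obtain ⟨j, hj, hxj⟩ := mem_iUnion₂.1 hx1
    exact (Set.disjoint_left.1 (h.disj j k hj) hxj hx).elim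

lemma image_subset_rest {i k : Fin 3} (hik : i ≠ k) : S i '' K ⊆ rest S₀ S K k :=
  fun _ hx => Or.inr (mem_biUnion (show i ∈ {j : Fin 3 | j ≠ k} from hik) hx)

/-- A connected subset of `K` meeting `S k K` and another piece contains the gluing point. -/
lemma glue_mem (h : StarSystem S₀ S A C K K' ρ) {D : Set ℂ} (hD : IsSubcontinuum K D) {k : Fin 3}
    {x y : ℂ} (hx : x ∈ D) (hxk : x ∈ S k '' K) (hy : y ∈ D) (hyk : y ∈ rest S₀ S K k) :
    S₀ (A k) ∈ D :=
  hD.isPreconnected.mem_of_inter_subset_singleton (h.isClosed_image k) (h.isClosed_rest k)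
    (hD.subset.trans (h.subset_image_union_rest k)) (h.image_inter_rest k) ⟨x, hx, hxk⟩
    ⟨y, hy, hyk⟩

lemma pull (h : StarSystem S₀ S A C K K' ρ) {D : Set ℂ} (hD : IsSubcontinuum K D) (k : Fin 3) :
    IsSubcontinuum K (K ∩ S k ⁻¹' D) := by
  refine ⟨inter_subset_left, h.isCompact.isClosed.inter (hD.isClosed.preimage (h.sim k).continuous),
    ?_⟩
  rw [← (h.sim k).isInducing.isPreconnected_image, image_inter_preimage, inter_comm]
  exact hD.isPreconnected.inter_of_inter_subset_singleton (h.isClosed_image k) (h.isClosed_rest k)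
    (hD.subset.trans (h.subset_image_union_rest k)) (h.image_inter_rest k)

lemma pull₀ (h : StarSystem S₀ S A C K K' ρ) {D : Set ℂ} (hD : IsSubcontinuum K D) :
    IsSubcontinuum K (K ∩ S₀ ⁻¹' D) := by
  refine ⟨inter_subset_left, h.isCompact.isClosed.inter (hD.isClosed.preimage h.sim₀.continuous),
    ?_⟩
  rw [← h.sim₀.isInducing.isPreconnected_image, image_inter_preimage]
  -- The central piece is what remains after cutting off the three outer ones.
  have hcut : ∀ (E : Set ℂ) (k : Fin 3), E ⊆ K → IsPreconnected E →
      IsPreconnected (E ∩ rest S₀ S K k) := fun E k hE hEc =>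
    hEc.inter_of_inter_subset_singleton (h.isClosed_rest k) (h.isClosed_image k)
      (hE.trans ((h.subset_image_union_rest k).trans (union_comm _ _).subset))
      ((inter_comm _ _).subset.trans (h.image_inter_rest k))
  have h3 := hcut _ 2 (inter_subset_left.trans (inter_subset_left.trans hD.subset))
    (hcut _ 1 (inter_subset_left.trans hD.subset) (hcut D 0 hD.subset hD.isPreconnected))
  convert h3 using 1
  ext x
  constructor
  · rintro ⟨hx, hxD⟩
    exact ⟨⟨⟨hxD, Or.inl hx⟩, Or.inl hx⟩, Or.inl hx⟩
  · rintro ⟨⟨⟨hxD, hx0⟩, hx1⟩, hx2⟩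
    have hx : ∀ k, x ∈ rest S₀ S K k := by
      intro k
      fin_cases k
      exacts [hx0, hx1, hx2]
    refine ⟨?_, hxD⟩
    rcases h.cases (hD.subset hxD) with hx' | ⟨j, hx'⟩
    · exact hx'
    · rcases hx j with hx0 | hx1
      · exact hx0
      · obtain ⟨i, hi, hxi⟩ := mem_iUnion₂.1 hx1
        exact (Set.disjoint_left.1 (h.disj i j hi) hxi hx').elim

/-- Four connected sets arranged in a star have a connected union. -/
lemma isPreconnected_star {E₀ : Set ℂ} {E : Fin 3 → Set ℂ} {b : Fin 3 → ℂ}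
    (h₀ : IsPreconnected E₀) (hE : ∀ k, IsPreconnected (E k)) (hb₀ : ∀ k, b k ∈ E₀)
    (hb : ∀ k, b k ∈ E k) : IsPreconnected (E₀ ∪ ⋃ k, E k) := by
  have : E₀ ∪ ⋃ k, E k = ⋃ k, (E₀ ∪ E k) := by rw [union_iUnion]
  rw [this]
  refine isPreconnected_iUnion ⟨b 0, mem_iInter.2 fun k => Or.inl (hb₀ 0)⟩ fun k => ?_
  exact h₀.union (b k) (hb₀ k) (hb k) (hE k)

/-! ### Paths between the points of `K'` -/

lemma exists_address (h : StarSystem S₀ S A C K K' ρ) (v : K') :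
    ∃ k, ∃ w : K', S k w = v := by
  obtain ⟨k, w, hw, hwv⟩ := mem_iUnion.1 (h.eq_union'.subset v.2)
  exact ⟨k, ⟨w, hw⟩, hwv⟩

/-- The index `k` of the piece `S k K'` containing a point of `K'`. -/
noncomputable def idx (h : StarSystem S₀ S A C K K' ρ) (v : K') : Fin 3 :=
  (h.exists_address v).choose

/-- The preimage of a point `v` of `K'` under `S (idx v)`. -/
noncomputable def shift (h : StarSystem S₀ S A C K K' ρ) (v : K') : K' :=
  (h.exists_address v).choose_spec.choose

lemma map_shift (h : StarSystem S₀ S A C K K' ρ) (v : K') : S (h.idx v) (h.shift v) = v :=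
  (h.exists_address v).choose_spec.choose_spec

lemma coe_mem (h : StarSystem S₀ S A C K K' ρ) (v : K') : (v : ℂ) ∈ K := h.subset v.2

/-- The vertex `A k` as a point of `K'`. -/
def vertex (h : StarSystem S₀ S A C K K' ρ) (k : Fin 3) : K' := ⟨A k, h.A_mem k⟩

/-- The gluing point `C k` as a point of `K'`. -/
def gluing (h : StarSystem S₀ S A C K K' ρ) (k : Fin 3) : K' := ⟨C k, h.C_mem' k⟩

lemma idx_eq_of_map_eq (h : StarSystem S₀ S A C K K' ρ) {v w : K'} {k : Fin 3}
    (hv : S k w = v) : h.idx v = k :=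
  h.eq_of_map_eq (h.coe_mem _) (h.coe_mem w) ((h.map_shift v).trans hv.symm)

lemma shift_eq_of_map_eq (h : StarSystem S₀ S A C K K' ρ) {v w : K'} {k : Fin 3}
    (hv : S k w = v) : h.shift v = w := by
  have h1 := h.map_shift v
  rw [h.idx_eq_of_map_eq hv, ← hv] at h1
  exact Subtype.ext ((h.sim k).injective h1)

lemma idx_vertex (h : StarSystem S₀ S A C K K' ρ) (k : Fin 3) : h.idx (h.vertex k) = k :=
  h.idx_eq_of_map_eq (w := h.vertex k) (h.A_fixed k)

lemma shift_vertex (h : StarSystem S₀ S A C K K' ρ) (k : Fin 3) :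
    h.shift (h.vertex k) = h.vertex k :=
  h.shift_eq_of_map_eq (k := k) (h.A_fixed k)

lemma vertex_ne_gluing (h : StarSystem S₀ S A C K K' ρ) (k : Fin 3) :
    h.vertex k ≠ h.gluing k :=
  fun hk => h.A_ne_C k (congrArg Subtype.val hk)

lemma vertex_injective (h : StarSystem S₀ S A C K K' ρ) : Function.Injective h.vertex :=
  fun _ _ hij => h.A_injective (congrArg Subtype.val hij)

open Classical in
/-- The time at which a path starting at `a` leaves the piece `S (idx a) K`; it is `0` if `a` is
itself the gluing point of that piece, so that no time is spent on a constant path. -/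
noncomputable def exitTime (h : StarSystem S₀ S A C K K' ρ) (a : K') : ℝ :=
  if h.shift a = h.gluing (h.idx a) then 0 else 1 / 3

open Classical in
/-- The time at which a path ending at `b` enters the piece `S (idx b) K`. -/
noncomputable def entryTime (h : StarSystem S₀ S A C K K' ρ) (b : K') : ℝ :=
  if h.shift b = h.gluing (h.idx b) then 1 else 2 / 3

lemma exitTime_nonneg (h : StarSystem S₀ S A C K K' ρ) (a : K') : 0 ≤ h.exitTime a := by
  unfold exitTime; split_ifs <;> norm_num

lemma exitTime_le (h : StarSystem S₀ S A C K K' ρ) (a : K') : h.exitTime a ≤ 1 / 3 := by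
  unfold exitTime; split_ifs <;> norm_num

lemma le_entryTime (h : StarSystem S₀ S A C K K' ρ) (a : K') : 2 / 3 ≤ h.entryTime a := by
  unfold entryTime; split_ifs <;> norm_num

lemma entryTime_le (h : StarSystem S₀ S A C K K' ρ) (a : K') : h.entryTime a ≤ 1 := by
  unfold entryTime; split_ifs <;> norm_num

open Classical in
/-- One step of the recursion for the path `φ a b` from `a` to `b` inside `K`: if `a` and `b` lie in
the same outer piece, so does the path; otherwise it runs to the gluing point of the first piece,
crosses the central piece, and proceeds inside the last piece to `b`. -/
noncomputable def step (h : StarSystem S₀ S A C K K' ρ) (φ : K' → K' → ℝ → ℂ) (a b : K')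
    (t : ℝ) : ℂ :=
  if h.idx a = h.idx b then S (h.idx a) (φ (h.shift a) (h.shift b) t)
  else if t < h.exitTime a then
    S (h.idx a) (φ (h.shift a) (h.gluing (h.idx a)) (t / h.exitTime a))
  else if t ≤ h.entryTime b then
    S₀ (φ (h.vertex (h.idx a)) (h.vertex (h.idx b))
      ((t - h.exitTime a) / (h.entryTime b - h.exitTime a)))
  else
    S (h.idx b) (φ (h.gluing (h.idx b)) (h.shift b)
      ((t - h.entryTime b) / (1 - h.entryTime b)))

lemma exists_step_eq (h : StarSystem S₀ S A C K K' ρ) (a b : K') {t : ℝ} (ht : t ∈ Icc (0 : ℝ) 1) :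
    ∃ f, (f = S₀ ∨ ∃ k, f = S k) ∧ ∃ a' b', ∃ t' ∈ Icc (0 : ℝ) 1, ∀ φ,
      h.step φ a b t = f (φ a' b' t') := by
  have h0 := h.exitTime_nonneg a
  have h1 := h.exitTime_le a
  have h2 := h.le_entryTime b
  have h3 := h.entryTime_le b
  by_cases hab : h.idx a = h.idx b
  · exact ⟨_, Or.inr ⟨_, rfl⟩, _, _, t, ht, fun φ => if_pos hab⟩
  by_cases hlt : t < h.exitTime a
  · exact ⟨_, Or.inr ⟨_, rfl⟩, _, _, t / h.exitTime a, ⟨div_nonneg ht.1 h0,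
      div_le_one_of_le₀ hlt.le h0⟩, fun φ => by rw [step, if_neg hab, if_pos hlt]⟩
  by_cases hle : t ≤ h.entryTime b
  · exact ⟨_, Or.inl rfl, _, _, (t - h.exitTime a) / (h.entryTime b - h.exitTime a),
      ⟨div_nonneg (by linarith) (by linarith), div_le_one_of_le₀ (by linarith) (by linarith)⟩,
      fun φ => by rw [step, if_neg hab, if_neg hlt, if_pos hle]⟩
  · exact ⟨_, Or.inr ⟨_, rfl⟩, _, _, (t - h.entryTime b) / (1 - h.entryTime b),
      ⟨div_nonneg (by linarith) (by linarith), div_le_one_of_le₀ (by linarith [ht.2])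
        (by linarith)⟩, fun φ => by rw [step, if_neg hab, if_neg hlt, if_neg hle]⟩

/-- A family of paths joining the points of `K'`, parametrized by `[0, 1]`. -/
structure IsPathFamily {K' : Set ℂ} (φ : K' → K' → ℝ → ℂ) : Prop where
  continuousOn : ∀ a b, ContinuousOn (φ a b) (Icc 0 1)
  zero : ∀ a b, φ a b 0 = a
  one : ∀ a b, φ a b 1 = b

section PathFamily

variable {φ : K' → K' → ℝ → ℂ} {a b : K'} {t : ℝ}

lemma step_same (h : StarSystem S₀ S A C K K' ρ) (hab : h.idx a = h.idx b) :
    h.step φ a b t = S (h.idx a) (φ (h.shift a) (h.shift b) t) :=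
  if_pos hab

lemma step_middle (h : StarSystem S₀ S A C K K' ρ) (hab : h.idx a ≠ h.idx b)
    (ht : t ∈ Icc (h.exitTime a) (h.entryTime b)) :
    h.step φ a b t = S₀ (φ (h.vertex (h.idx a)) (h.vertex (h.idx b))
      ((t - h.exitTime a) / (h.entryTime b - h.exitTime a))) := by
  rw [step, if_neg hab, if_neg ht.1.not_gt, if_pos ht.2]

lemma step_first (h : StarSystem S₀ S A C K K' ρ) (hφ : IsPathFamily φ) (hab : h.idx a ≠ h.idx b)
    (ht : t ∈ Icc 0 (h.exitTime a)) :
    h.step φ a b t =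
      S (h.idx a) (φ (h.shift a) (h.gluing (h.idx a)) (t / h.exitTime a)) := by
  rcases ht.2.lt_or_eq with hlt | rfl
  · rw [step, if_neg hab, if_pos hlt]
  · have := h.exitTime_le a
    have := h.le_entryTime b
    rw [h.step_middle hab ⟨le_rfl, by linarith⟩, sub_self, zero_div, hφ.zero]
    by_cases hz : h.shift a = h.gluing (h.idx a)
    · -- Both times vanish, and `0 / 0 = 0`.
      have h0 : h.exitTime a = 0 := by rw [exitTime, if_pos hz]
      rw [h0, div_zero, hφ.zero, hz]
      exact h.glue _
    · have h0 : h.exitTime a ≠ 0 := by rw [exitTime, if_neg hz]; norm_num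
      rw [div_self h0, hφ.one]
      exact h.glue _

lemma step_last (h : StarSystem S₀ S A C K K' ρ) (hφ : IsPathFamily φ) (hab : h.idx a ≠ h.idx b)
    (ht : t ∈ Icc (h.entryTime b) 1) :
    h.step φ a b t = S (h.idx b) (φ (h.gluing (h.idx b)) (h.shift b)
      ((t - h.entryTime b) / (1 - h.entryTime b))) := by
  have h1 := h.exitTime_le a
  have h2 := h.le_entryTime b
  rcases ht.1.lt_or_eq with hlt | rfl
  · rw [step, if_neg hab, if_neg (by linarith), if_neg hlt.not_ge]
  · rw [h.step_middle hab ⟨by linarith, le_rfl⟩, sub_self, zero_div, hφ.zero,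
      div_self (by linarith), hφ.one]
    exact h.glue _

lemma continuousOn_step (h : StarSystem S₀ S A C K K' ρ) (hφ : IsPathFamily φ) (a b : K') :
    ContinuousOn (h.step φ a b) (Icc 0 1) := by
  have h0 := h.exitTime_nonneg a
  have h1 := h.exitTime_le a
  have h2 := h.le_entryTime b
  have h3 := h.entryTime_le b
  by_cases hab : h.idx a = h.idx b
  · exact ((h.sim _).continuous.comp_continuousOn (hφ.continuousOn _ _)).congr
      fun t _ => h.step_same hab
  have e1 : ContinuousOn (h.step φ a b) (Icc 0 (h.exitTime a)) := by
    refine ContinuousOn.congr ?_ fun t ht => h.step_first hφ hab ht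
    refine (h.sim _).continuous.comp_continuousOn ((hφ.continuousOn _ _).comp
      (by fun_prop) fun t ht => ⟨div_nonneg ht.1 h0, div_le_one_of_le₀ ht.2 h0⟩)
  have e2 : ContinuousOn (h.step φ a b) (Icc (h.exitTime a) (h.entryTime b)) := by
    refine ContinuousOn.congr ?_ fun t ht => h.step_middle hab ht
    refine h.sim₀.continuous.comp_continuousOn ((hφ.continuousOn _ _).comp
      (by fun_prop) fun t ht => ⟨div_nonneg (by linarith [ht.1]) (by linarith),
        div_le_one_of_le₀ (by linarith [ht.2]) (by linarith)⟩)
  have e3 : ContinuousOn (h.step φ a b) (Icc (h.entryTime b) 1) := by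
    refine ContinuousOn.congr ?_ fun t ht => h.step_last hφ hab ht
    refine (h.sim _).continuous.comp_continuousOn ((hφ.continuousOn _ _).comp
      (by fun_prop) fun t ht => ⟨div_nonneg (by linarith [ht.1]) (by linarith),
        div_le_one_of_le₀ (by linarith [ht.2]) (by linarith)⟩)
  have := (e1.union_of_isClosed e2 isClosed_Icc isClosed_Icc).union_of_isClosed e3
    (isClosed_Icc.union isClosed_Icc) isClosed_Icc
  rwa [Icc_union_Icc_eq_Icc h0 (by linarith), Icc_union_Icc_eq_Icc (by linarith) h3] at this

lemma isPathFamily_step (h : StarSystem S₀ S A C K K' ρ) (hφ : IsPathFamily φ) :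
    IsPathFamily (h.step φ) := by
  refine ⟨h.continuousOn_step hφ, fun a b => ?_, fun a b => ?_⟩
  · by_cases hab : h.idx a = h.idx b
    · rw [h.step_same hab, hφ.zero, h.map_shift]
    · rw [h.step_first hφ hab ⟨le_rfl, h.exitTime_nonneg a⟩, zero_div, hφ.zero, h.map_shift]
  · by_cases hab : h.idx a = h.idx b
    · rw [h.step_same hab, hφ.one, hab, h.map_shift]
    · rw [h.step_last hφ hab ⟨h.entryTime_le b, le_rfl⟩]
      by_cases hz : h.shift b = h.gluing (h.idx b)
      · rw [← hz, entryTime, if_pos hz, sub_self, div_zero, hφ.zero, h.map_shift]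
      · have h1 : 1 - h.entryTime b ≠ 0 := by rw [entryTime, if_neg hz]; norm_num
        rw [div_self h1, hφ.one, h.map_shift]

end PathFamily

/-- The paths in `K` joining the points of `K'`, as a fixed point of `step`. -/
structure IsArcFamily (h : StarSystem S₀ S A C K K' ρ) (Φ : K' → K' → ℝ → ℂ) : Prop
    extends IsPathFamily Φ where
  fixed : ∀ a b, ∀ t ∈ Icc (0 : ℝ) 1, Φ a b t = h.step Φ a b t
  bounded : ∃ R, ∀ a b, ∀ t ∈ Icc (0 : ℝ) 1, ‖Φ a b t‖ ≤ R

lemma exists_forall_mem_closedBall (h : StarSystem S₀ S A C K K' ρ) :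
    ∃ R, 0 ≤ R ∧ (∀ x ∈ K', ‖x‖ ≤ R) ∧ ∀ f, (f = S₀ ∨ ∃ k, f = S k) → ∀ x, ‖x‖ ≤ R → ‖f x‖ ≤ R := by
  obtain ⟨R₀, hR₀⟩ := h.isCompact'.isBounded.exists_norm_le
  set m : ℝ := ‖S₀ 0‖ + (‖S 0 0‖ + ‖S 1 0‖ + ‖S 2 0‖) with hm
  have hρ := h.lt_one
  refine ⟨max R₀ (m / (1 - ρ)), le_max_of_le_right (div_nonneg (by positivity) (by linarith)),
    fun x hx => le_max_of_le_left (hR₀ x hx), ?_⟩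
  intro f hf x hx
  set R := max R₀ (m / (1 - ρ))
  have hmR : m ≤ R * (1 - ρ) := by
    rw [← div_le_iff₀ (by linarith)]
    exact le_max_right _ _
  have hf0 : ‖f 0‖ ≤ m := by
    have n0 := norm_nonneg (S 0 0)
    have n1 := norm_nonneg (S 1 0)
    have n2 := norm_nonneg (S 2 0)
    have n3 := norm_nonneg (S₀ 0)
    rcases hf with rfl | ⟨k, rfl⟩
    · linarith
    · fin_cases k <;> simp only [Fin.zero_eta, Fin.mk_one, Fin.reduceFinMk] <;> linarith
  have hfs : IsSimilarityLE ρ f := by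
    rcases hf with rfl | ⟨k, rfl⟩
    exacts [h.sim₀, h.sim k]
  have h1 := hfs.dist_le x 0
  rw [dist_zero_right, dist_eq_norm] at h1
  have h2 : ρ * ‖x‖ ≤ ρ * R := mul_le_mul_of_nonneg_left hx h.pos.le
  have h3 : ‖f x‖ ≤ ‖f x - f 0‖ + ‖f 0‖ := by
    simpa using norm_add_le (f x - f 0) (f 0)
  linarith

/-- The iterates of `step`, started at the segments, converge uniformly to a family of paths. -/
lemma exists_isArcFamily (h : StarSystem S₀ S A C K K' ρ) : ∃ Φ, h.IsArcFamily Φ := by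
  obtain ⟨R, hR0, hRK, hRS⟩ := h.exists_forall_mem_closedBall
  set φ₀ : K' → K' → ℝ → ℂ := fun a b t => AffineMap.lineMap (a : ℂ) (b : ℂ) t with hφ₀
  set φ : ℕ → K' → K' → ℝ → ℂ := fun n => h.step^[n] φ₀ with hφdef
  have hsucc : ∀ n, φ (n + 1) = h.step (φ n) := fun n => Function.iterate_succ_apply' _ _ _
  have hpath : ∀ n, IsPathFamily (φ n) := by
    intro n
    induction n with
    | zero =>
      refine ⟨fun a b => ?_, fun a b => ?_, fun a b => ?_⟩
      · exact (AffineMap.lineMap_continuous (R := ℝ)).continuousOn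
      · exact AffineMap.lineMap_apply_zero _ _
      · exact AffineMap.lineMap_apply_one _ _
    | succ n ih => rw [hsucc]; exact h.isPathFamily_step ih
  have hnorm : ∀ n a b, ∀ t ∈ Icc (0 : ℝ) 1, ‖φ n a b t‖ ≤ R := by
    intro n
    induction n with
    | zero =>
      intro a b t ht
      exact mem_closedBall_zero_iff.1 ((convex_closedBall (0 : ℂ) R).lineMap_mem
        (mem_closedBall_zero_iff.2 (hRK a a.2)) (mem_closedBall_zero_iff.2 (hRK b b.2)) ht)
    | succ n ih =>
      intro a b t ht
      obtain ⟨f, hf, a', b', t', ht', hstep⟩ := h.exists_step_eq a b ht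
      rw [hsucc, hstep]
      exact hRS f hf _ (ih a' b' t' ht')
  have hdist : ∀ n a b, ∀ t ∈ Icc (0 : ℝ) 1,
      dist (φ n a b t) (φ (n + 1) a b t) ≤ 2 * R * ρ ^ n := by
    intro n
    induction n with
    | zero =>
      intro a b t ht
      rw [pow_zero, mul_one, dist_eq_norm]
      exact (norm_sub_le _ _).trans (by linarith [hnorm 0 a b t ht, hnorm (0 + 1) a b t ht])
    | succ n ih =>
      intro a b t ht
      obtain ⟨f, hf, a', b', t', ht', hstep⟩ := h.exists_step_eq a b ht
      have hfs : IsSimilarityLE ρ f := by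
        rcases hf with rfl | ⟨k, rfl⟩
        exacts [h.sim₀, h.sim k]
      rw [hsucc (n + 1), hsucc n, hstep, hstep, ← hsucc n]
      calc _ ≤ ρ * dist (φ n a' b' t') (φ (n + 1) a' b' t') := hfs.dist_le _ _
        _ ≤ ρ * (2 * R * ρ ^ n) := mul_le_mul_of_nonneg_left (ih a' b' t' ht') h.pos.le
        _ = _ := by ring
  have hlim : ∀ a b t, ∃ l, t ∈ Icc (0 : ℝ) 1 → Tendsto (fun n => φ n a b t) atTop (𝓝 l) := by
    intro a b t
    by_cases ht : t ∈ Icc (0 : ℝ) 1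
    · obtain ⟨l, hl⟩ := cauchySeq_tendsto_of_complete
        (cauchySeq_of_le_geometric ρ (2 * R) h.lt_one fun n => hdist n a b t ht)
      exact ⟨l, fun _ => hl⟩
    · exact ⟨0, fun h => absurd h ht⟩
  choose Φ hΦ using hlim
  refine ⟨Φ, ⟨fun a b => ?_, fun a b => ?_, fun a b => ?_⟩, fun a b t ht => ?_,
    R, fun a b t ht => le_of_tendsto' (hΦ a b t ht).norm fun n => hnorm n a b t ht⟩
  · refine TendstoUniformlyOn.continuousOn (F := fun n => φ n a b) (p := atTop) ?_
      (Frequently.of_forall fun n => (hpath n).continuousOn a b)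
    rw [Metric.tendstoUniformlyOn_iff]
    intro ε hε
    have h0 : Tendsto (fun n : ℕ => 2 * R * ρ ^ n / (1 - ρ)) atTop (𝓝 (2 * R * 0 / (1 - ρ))) :=
      ((tendsto_pow_atTop_nhds_zero_of_lt_one h.pos.le h.lt_one).const_mul _).div_const _
    rw [mul_zero, zero_div] at h0
    filter_upwards [h0.eventually (gt_mem_nhds hε)] with n hn t ht
    rw [dist_comm]
    exact (dist_le_of_le_geometric_of_tendsto ρ (2 * R) h.lt_one (fun n => hdist n a b t ht)
      (hΦ a b t ht) n).trans_lt hn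
  · exact tendsto_nhds_unique (hΦ a b 0 (by simp))
      (by simp only [(hpath _).zero]; exact tendsto_const_nhds)
  · exact tendsto_nhds_unique (hΦ a b 1 (by simp))
      (by simp only [(hpath _).one]; exact tendsto_const_nhds)
  · obtain ⟨f, hf, a', b', t', ht', hstep⟩ := h.exists_step_eq a b ht
    have hfc : Continuous f := by
      rcases hf with rfl | ⟨k, rfl⟩
      exacts [h.sim₀.continuous, (h.sim k).continuous]
    rw [hstep]
    refine tendsto_nhds_unique ((tendsto_add_atTop_iff_nat 1).2 (hΦ a b t ht)) ?_
    simp only [hsucc, hstep]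
    exact (hfc.tendsto _).comp (hΦ a' b' t' ht')

lemma exitTime_eq_zero (h : StarSystem S₀ S A C K K' ρ) {a : K'}
    (ha : h.shift a = h.gluing (h.idx a)) : h.exitTime a = 0 := if_pos ha

lemma exitTime_eq (h : StarSystem S₀ S A C K K' ρ) {a : K'}
    (ha : h.shift a ≠ h.gluing (h.idx a)) : h.exitTime a = 1 / 3 := if_neg ha

lemma entryTime_eq_one (h : StarSystem S₀ S A C K K' ρ) {b : K'}
    (hb : h.shift b = h.gluing (h.idx b)) : h.entryTime b = 1 := if_pos hb

lemma entryTime_eq (h : StarSystem S₀ S A C K K' ρ) {b : K'}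
    (hb : h.shift b ≠ h.gluing (h.idx b)) : h.entryTime b = 2 / 3 := if_neg hb

lemma shift_vertex_ne (h : StarSystem S₀ S A C K K' ρ) (k : Fin 3) :
    h.shift (h.vertex k) ≠ h.gluing (h.idx (h.vertex k)) := by
  rw [h.shift_vertex, h.idx_vertex]
  exact h.vertex_ne_gluing k

namespace IsArcFamily

variable {h : StarSystem S₀ S A C K K' ρ} {Φ : K' → K' → ℝ → ℂ} {a b : K'} {s t : ℝ}

lemma exists_eq (hΦ : h.IsArcFamily Φ) (a b : K') (ht : t ∈ Icc (0 : ℝ) 1) :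
    ∃ f, (f = S₀ ∨ ∃ k, f = S k) ∧ ∃ a' b', ∃ t' ∈ Icc (0 : ℝ) 1,
      Φ a b t = f (Φ a' b' t') := by
  obtain ⟨f, hf, a', b', t', ht', hstep⟩ := h.exists_step_eq a b ht
  exact ⟨f, hf, a', b', t', ht', (hΦ.fixed a b t ht).trans (hstep Φ)⟩

lemma exists_infDist_le (hΦ : h.IsArcFamily Φ) : ∃ M, ∀ D : Set ℂ, D ⊆ K → D.Nonempty →
    ∀ a b, ∀ t ∈ Icc (0 : ℝ) 1, Metric.infDist (Φ a b t) D ≤ M := by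
  obtain ⟨R, hR⟩ := hΦ.bounded
  obtain ⟨R', hR'⟩ := h.isCompact.isBounded.exists_norm_le
  refine ⟨R + R', fun D hD ⟨x, hx⟩ a b t ht => (Metric.infDist_le_dist_of_mem hx).trans ?_⟩
  rw [dist_eq_norm]
  exact (norm_sub_le _ _).trans (add_le_add (hR a b t ht) (hR' x (hD hx)))

lemma mem (hΦ : h.IsArcFamily Φ) (a b : K') (ht : t ∈ Icc (0 : ℝ) 1) : Φ a b t ∈ K := by
  obtain ⟨M, hM⟩ := hΦ.exists_infDist_le
  have hne : K.Nonempty := ⟨a, h.coe_mem a⟩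
  have := nonpos_of_forall_le_mul (Y := {y : K' × K' × ℝ // y.2.2 ∈ Icc (0 : ℝ) 1}) h.pos.le
    h.lt_one (fun y => Metric.infDist (Φ y.1.1 y.1.2.1 y.1.2.2) K)
    (fun y => hM K Subset.rfl hne _ _ _ y.2) ?_ ⟨(a, b, t), ht⟩
  · rw [h.isCompact.isClosed.mem_iff_infDist_zero hne]
    exact le_antisymm this Metric.infDist_nonneg
  · rintro ⟨⟨a, b, t⟩, ht⟩
    obtain ⟨f, hf, a', b', t', ht', heq⟩ := hΦ.exists_eq a b ht
    refine ⟨⟨(a', b', t'), ht'⟩, ?_⟩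
    dsimp only
    rw [heq]
    rcases hf with rfl | ⟨k, rfl⟩
    · exact h.sim₀.infDist_le hne (fun y => h.map₀_mem) _
    · exact (h.sim k).infDist_le hne (fun y => h.map_mem k) _

lemma eq_same (hΦ : h.IsArcFamily Φ) (hab : h.idx a = h.idx b) (ht : t ∈ Icc (0 : ℝ) 1) :
    Φ a b t = S (h.idx a) (Φ (h.shift a) (h.shift b) t) :=
  (hΦ.fixed a b t ht).trans (h.step_same hab)

lemma eq_first (hΦ : h.IsArcFamily Φ) (hab : h.idx a ≠ h.idx b) (h0 : 0 ≤ t)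
    (h1 : t ≤ h.exitTime a) : t / h.exitTime a ∈ Icc (0 : ℝ) 1 ∧
      Φ a b t = S (h.idx a) (Φ (h.shift a) (h.gluing (h.idx a)) (t / h.exitTime a)) :=
  ⟨⟨div_nonneg h0 (h0.trans h1), div_le_one_of_le₀ h1 (h0.trans h1)⟩,
    (hΦ.fixed a b t ⟨h0, h1.trans ((h.exitTime_le a).trans (by norm_num))⟩).trans
      (h.step_first hΦ.toIsPathFamily hab ⟨h0, h1⟩)⟩

lemma eq_middle (hΦ : h.IsArcFamily Φ) (hab : h.idx a ≠ h.idx b) (h0 : h.exitTime a ≤ t)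
    (h1 : t ≤ h.entryTime b) :
    (t - h.exitTime a) / (h.entryTime b - h.exitTime a) ∈ Icc (0 : ℝ) 1 ∧
      Φ a b t = S₀ (Φ (h.vertex (h.idx a)) (h.vertex (h.idx b))
        ((t - h.exitTime a) / (h.entryTime b - h.exitTime a))) :=
  ⟨⟨div_nonneg (by linarith) (by linarith), div_le_one_of_le₀ (by linarith) (by linarith)⟩,
    (hΦ.fixed a b t ⟨(h.exitTime_nonneg a).trans h0, h1.trans (h.entryTime_le b)⟩).trans
      (h.step_middle hab ⟨h0, h1⟩)⟩

lemma eq_last (hΦ : h.IsArcFamily Φ) (hab : h.idx a ≠ h.idx b) (h0 : h.entryTime b ≤ t)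
    (h1 : t ≤ 1) : (t - h.entryTime b) / (1 - h.entryTime b) ∈ Icc (0 : ℝ) 1 ∧
      Φ a b t = S (h.idx b) (Φ (h.gluing (h.idx b)) (h.shift b)
        ((t - h.entryTime b) / (1 - h.entryTime b))) :=
  ⟨⟨div_nonneg (by linarith) (by linarith), div_le_one_of_le₀ (by linarith) (by linarith)⟩,
    (hΦ.fixed a b t ⟨by linarith [h.le_entryTime b], h1⟩).trans
      (h.step_last hΦ.toIsPathFamily hab ⟨h0, h1⟩)⟩

/-! ### The paths are contained in every connecting continuum -/

/-- Every subcontinuum of `K` containing `a` and `b` contains the path from `a` to `b`: it passes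
through the gluing points between the pieces containing `a` and `b`, and its preimages in these
pieces are again subcontinua of `K`, so the distance of the path to it is contracted by `ρ`. -/
lemma mem_subcontinuum (hΦ : h.IsArcFamily Φ) {D : Set ℂ} (hD : IsSubcontinuum K D)
    (ha : (a : ℂ) ∈ D) (hb : (b : ℂ) ∈ D) (ht : t ∈ Icc (0 : ℝ) 1) : Φ a b t ∈ D := by
  obtain ⟨M, hM⟩ := hΦ.exists_infDist_le
  have := nonpos_of_forall_le_mul (Y := {y : Set ℂ × K' × K' × ℝ // IsSubcontinuum K y.1 ∧
      (y.2.1 : ℂ) ∈ y.1 ∧ (y.2.2.1 : ℂ) ∈ y.1 ∧ y.2.2.2 ∈ Icc (0 : ℝ) 1}) h.pos.le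
    h.lt_one (fun y => Metric.infDist (Φ y.1.2.1 y.1.2.2.1 y.1.2.2.2) y.1.1)
    (fun y => hM _ y.2.1.subset ⟨_, y.2.2.1⟩ _ _ _ y.2.2.2.2) ?_ ⟨(D, a, b, t), hD, ha, hb, ht⟩
  · rw [hD.isClosed.mem_iff_infDist_zero ⟨_, ha⟩]
    exact le_antisymm this Metric.infDist_nonneg
  · rintro ⟨⟨D, a, b, t⟩, hD, ha, hb, ht⟩
    have hpull : ∀ k (x : K'), S k x ∈ D → (x : ℂ) ∈ K ∩ S k ⁻¹' D := fun k x hx =>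
      ⟨h.coe_mem x, hx⟩
    have hsa := hpull (h.idx a) (h.shift a) (by rwa [h.map_shift])
    have hsb := hpull (h.idx b) (h.shift b) (by rwa [h.map_shift])
    dsimp only at hD ha hb ht ⊢
    by_cases hab : h.idx a = h.idx b
    · refine ⟨⟨(_, _, _, t), h.pull hD (h.idx a), hsa, hab ▸ hsb, ht⟩, ?_⟩
      dsimp only
      rw [hΦ.eq_same hab ht]
      exact (h.sim _).infDist_le ⟨_, hsa⟩ (fun y hy => hy.2) _
    have hia : (a : ℂ) ∈ S (h.idx a) '' K := ⟨_, h.coe_mem _, h.map_shift a⟩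
    have hib : (b : ℂ) ∈ S (h.idx b) '' K := ⟨_, h.coe_mem _, h.map_shift b⟩
    have hga : S₀ (A (h.idx a)) ∈ D :=
      h.glue_mem hD ha hia hb (image_subset_rest (Ne.symm hab) hib)
    have hgb : S₀ (A (h.idx b)) ∈ D := h.glue_mem hD hb hib ha (image_subset_rest hab hia)
    have hga' := hpull (h.idx a) (h.gluing (h.idx a)) (by rw [gluing, ← h.glue]; exact hga)
    have hgb' := hpull (h.idx b) (h.gluing (h.idx b)) (by rw [gluing, ← h.glue]; exact hgb)
    rcases le_total t (h.exitTime a) with h1 | h1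
    · obtain ⟨ht', heq⟩ := hΦ.eq_first hab ht.1 h1
      refine ⟨⟨(_, _, _, _), h.pull hD (h.idx a), hsa, hga', ht'⟩, ?_⟩
      dsimp only
      rw [heq]
      exact (h.sim _).infDist_le ⟨_, hsa⟩ (fun y hy => hy.2) _
    rcases le_total t (h.entryTime b) with h2 | h2
    · obtain ⟨ht', heq⟩ := hΦ.eq_middle hab h1 h2
      have hva : (h.vertex (h.idx a) : ℂ) ∈ K ∩ S₀ ⁻¹' D := ⟨h.coe_mem _, hga⟩
      have hvb : (h.vertex (h.idx b) : ℂ) ∈ K ∩ S₀ ⁻¹' D := ⟨h.coe_mem _, hgb⟩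
      refine ⟨⟨(_, _, _, _), h.pull₀ hD, hva, hvb, ht'⟩, ?_⟩
      dsimp only
      rw [heq]
      exact h.sim₀.infDist_le ⟨_, hva⟩ (fun y hy => hy.2) _
    · obtain ⟨ht', heq⟩ := hΦ.eq_last hab h2 ht.2
      refine ⟨⟨(_, _, _, _), h.pull hD (h.idx b), hgb', hsb, ht'⟩, ?_⟩
      dsimp only
      rw [heq]
      exact (h.sim _).infDist_le ⟨_, hsb⟩ (fun y hy => hy.2) _

/-! ### The paths are injective -/

/-- The path between distinct points is similar to one whose endpoints lie in different pieces. -/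
lemma exists_idx_ne (hΦ : h.IsArcFamily Φ) (hab : a ≠ b) : ∃ g : ℂ → ℂ, Function.Injective g ∧
    ∃ a' b', h.idx a' ≠ h.idx b' ∧ ∀ t ∈ Icc (0 : ℝ) 1, Φ a b t = g (Φ a' b' t) := by
  obtain ⟨M, hM⟩ := Metric.isBounded_iff.1 h.isCompact.isBounded
  have key : ∀ n : ℕ, ∀ a b : K', ρ ^ n * M < dist (a : ℂ) b → ∃ g : ℂ → ℂ, Function.Injective g ∧
      ∃ a' b', h.idx a' ≠ h.idx b' ∧ ∀ t ∈ Icc (0 : ℝ) 1, Φ a b t = g (Φ a' b' t) := by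
    intro n
    induction n with
    | zero =>
      intro a b hlt
      rw [pow_zero, one_mul] at hlt
      exact absurd (hM (h.coe_mem a) (h.coe_mem b)) hlt.not_ge
    | succ n ih =>
      intro a b hlt
      by_cases hab : h.idx a = h.idx b
      · have hd := (h.sim (h.idx a)).dist_le (h.shift a) (h.shift b)
        rw [h.map_shift, hab, h.map_shift] at hd
        obtain ⟨g, hg, a', b', hab', hgt⟩ := ih (h.shift a) (h.shift b)
          (lt_of_mul_lt_mul_left (by rw [← mul_assoc, ← pow_succ']; exact hlt.trans_le hd) h.pos.le)
        exact ⟨S (h.idx a) ∘ g, (h.sim _).injective.comp hg, a', b', hab', fun t ht => by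
          rw [hΦ.eq_same hab ht, hgt t ht]; rfl⟩
      · exact ⟨id, Function.injective_id, a, b, hab, fun _ _ => rfl⟩
  obtain ⟨n, hn⟩ := h.exists_pow_mul_lt M (dist_pos.2 fun hab' => hab (Subtype.ext hab'))
  exact key n a b hn

/-- A path does not return to its starting point: a return time would be rescaled by a factor of at
least `3 / 2` in two steps of the recursion. -/
lemma eq_zero_of_eq_left (hΦ : h.IsArcFamily Φ) (hab : a ≠ b) (ht : t ∈ Icc (0 : ℝ) 1)
    (heq : Φ a b t = a) : t = 0 := by
  set Y := {y : K' × K' × ℝ // y.1 ≠ y.2.1 ∧ y.2.2 ∈ Icc (0 : ℝ) 1 ∧ Φ y.1 y.2.1 y.2.2 = y.1}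
  have aux : ∀ a b, h.idx a ≠ h.idx b → ∀ t ∈ Icc (0 : ℝ) 1, Φ a b t = a →
      (∃ y : Y, t ≤ 2 / 3 * y.1.2.2) ∨ (h.shift a = h.gluing (h.idx a) ∧
        ∃ i j, i ≠ j ∧ ∃ t' ∈ Icc (0 : ℝ) 1, Φ (h.vertex i) (h.vertex j) t' = h.vertex i ∧
          t ≤ t') := by
    intro a b hab t ht heq
    have hne : a ≠ b := fun e => hab (e ▸ rfl)
    have hsa := h.map_shift a
    rcases le_total t (h.exitTime a) with h1 | h1
    · left
      obtain ⟨ht', heq'⟩ := hΦ.eq_first hab ht.1 h1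
      by_cases hz : h.shift a = h.gluing (h.idx a)
      · rw [h.exitTime_eq_zero hz] at h1
        obtain rfl : t = 0 := le_antisymm h1 ht.1
        exact ⟨⟨(a, b, 0), hne, ht, heq⟩, by simp⟩
      · refine ⟨⟨(_, _, _), hz, ht', (h.sim (h.idx a)).injective ?_⟩, ?_⟩
        · exact heq'.symm.trans (heq.trans hsa.symm)
        · dsimp only
          rw [h.exitTime_eq hz]
          linarith [ht.1]
    rcases le_total t (h.entryTime b) with h2 | h2
    · right
      obtain ⟨ht', heq'⟩ := hΦ.eq_middle hab h1 h2
      obtain ⟨e1, e2⟩ := h.eq_of_map₀_eq (hΦ.mem _ _ ht') (h.coe_mem (h.shift a))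
        (heq'.symm.trans (heq.trans hsa.symm))
      have hz : h.shift a = h.gluing (h.idx a) := Subtype.ext e2
      refine ⟨hz, _, _, hab, _, ht', e1, ?_⟩
      have := h.le_entryTime b
      rw [h.exitTime_eq_zero hz, sub_zero, sub_zero, le_div_iff₀ (by linarith)]
      nlinarith [h.entryTime_le b, ht.1]
    · obtain ⟨ht', heq'⟩ := hΦ.eq_last hab h2 ht.2
      exact absurd (h.eq_of_map_eq (hΦ.mem _ _ ht') (h.coe_mem (h.shift a))
        (heq'.symm.trans (heq.trans hsa.symm))).symm hab
  have hstep : ∀ y : Y, ∃ y' : Y, y.1.2.2 ≤ 2 / 3 * y'.1.2.2 := by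
    rintro ⟨⟨a, b, t⟩, hab, ht, heq⟩
    dsimp only at hab ht heq ⊢
    obtain ⟨g, hg, a', b', hab', hgt⟩ := hΦ.exists_idx_ne hab
    have heq' : Φ a' b' t = a' := hg (by
      rw [← hgt t ht, heq, ← hΦ.zero a b, hgt 0 (by simp), hΦ.zero])
    rcases aux a' b' hab' t ht heq' with hy | ⟨-, i, j, hij, t', ht', heq'', hle⟩
    · exact hy
    · rcases aux (h.vertex i) (h.vertex j) (by rwa [h.idx_vertex, h.idx_vertex]) t' ht' heq'' with
        ⟨y, hy⟩ | ⟨hz, -⟩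
      · exact ⟨y, hle.trans hy⟩
      · exact absurd hz (h.shift_vertex_ne i)
  exact le_antisymm (nonpos_of_forall_le_mul (ρ := 2 / 3) (M := 1) (by norm_num) (by norm_num)
    (fun y : Y => y.1.2.2) (fun y => y.2.2.1.2) hstep ⟨(a, b, t), hab, ht, heq⟩) ht.1

/-- A path reaches its endpoint only at time `1`. -/
lemma eq_one_of_eq_right (hΦ : h.IsArcFamily Φ) (hab : a ≠ b) (ht : t ∈ Icc (0 : ℝ) 1)
    (heq : Φ a b t = b) : t = 1 := by
  set Y := {y : K' × K' × ℝ // y.1 ≠ y.2.1 ∧ y.2.2 ∈ Icc (0 : ℝ) 1 ∧ Φ y.1 y.2.1 y.2.2 = y.2.1}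
  have aux : ∀ a b, h.idx a ≠ h.idx b → ∀ t ∈ Icc (0 : ℝ) 1, Φ a b t = b →
      (∃ y : Y, 1 - t ≤ 2 / 3 * (1 - y.1.2.2)) ∨ (h.shift b = h.gluing (h.idx b) ∧
        ∃ i j, i ≠ j ∧ ∃ t' ∈ Icc (0 : ℝ) 1, Φ (h.vertex i) (h.vertex j) t' = h.vertex j ∧
          1 - t ≤ 1 - t') := by
    intro a b hab t ht heq
    have hne : a ≠ b := fun e => hab (e ▸ rfl)
    have hsb := h.map_shift b
    rcases le_total (h.entryTime b) t with h1 | h1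
    · left
      obtain ⟨ht', heq'⟩ := hΦ.eq_last hab h1 ht.2
      by_cases hz : h.shift b = h.gluing (h.idx b)
      · rw [h.entryTime_eq_one hz] at h1
        obtain rfl : t = 1 := le_antisymm ht.2 h1
        exact ⟨⟨(a, b, 1), hne, ht, heq⟩, by simp⟩
      · refine ⟨⟨(_, _, _), Ne.symm hz, ht', (h.sim (h.idx b)).injective ?_⟩, ?_⟩
        · exact heq'.symm.trans (heq.trans hsb.symm)
        · dsimp only
          rw [h.entryTime_eq hz, show (1 : ℝ) - 2 / 3 = 1 / 3 by norm_num]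
          linarith [ht.2]
    rcases le_total (h.exitTime a) t with h2 | h2
    · right
      obtain ⟨ht', heq'⟩ := hΦ.eq_middle hab h2 h1
      obtain ⟨e1, e2⟩ := h.eq_of_map₀_eq (hΦ.mem _ _ ht') (h.coe_mem (h.shift b))
        (heq'.symm.trans (heq.trans hsb.symm))
      have hz : h.shift b = h.gluing (h.idx b) := Subtype.ext e2
      refine ⟨hz, _, _, hab, _, ht', e1, ?_⟩
      have := h.exitTime_le a
      have hle : (t - h.exitTime a) / (1 - h.exitTime a) ≤ t := by
        rw [div_le_iff₀ (by linarith)]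
        nlinarith [h.exitTime_nonneg a, ht.2]
      rw [h.entryTime_eq_one hz]
      linarith
    · obtain ⟨ht', heq'⟩ := hΦ.eq_first hab ht.1 h2
      exact absurd (h.eq_of_map_eq (hΦ.mem _ _ ht') (h.coe_mem (h.shift b))
        (heq'.symm.trans (heq.trans hsb.symm))) hab
  have hstep : ∀ y : Y, ∃ y' : Y, 1 - y.1.2.2 ≤ 2 / 3 * (1 - y'.1.2.2) := by
    rintro ⟨⟨a, b, t⟩, hab, ht, heq⟩
    dsimp only at hab ht heq ⊢
    obtain ⟨g, hg, a', b', hab', hgt⟩ := hΦ.exists_idx_ne hab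
    have heq' : Φ a' b' t = b' := hg (by
      rw [← hgt t ht, heq, ← hΦ.one a b, hgt 1 (by simp), hΦ.one])
    rcases aux a' b' hab' t ht heq' with hy | ⟨-, i, j, hij, t', ht', heq'', hle⟩
    · exact hy
    · rcases aux (h.vertex i) (h.vertex j) (by rwa [h.idx_vertex, h.idx_vertex]) t' ht' heq'' with
        ⟨y, hy⟩ | ⟨hz, -⟩
      · exact ⟨y, hle.trans hy⟩
      · exact absurd hz (h.shift_vertex_ne j)
  have := nonpos_of_forall_le_mul (ρ := 2 / 3) (M := 1) (by norm_num) (by norm_num)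
    (fun y : Y => 1 - y.1.2.2) (fun y => by linarith [y.2.2.1.1]) hstep ⟨(a, b, t), hab, ht, heq⟩
  exact le_antisymm ht.2 (by linarith)

/-- The times of a double point differ by more and more when followed through the recursion,
since points of different parts of a path coincide only at the common endpoint of these parts. -/
lemma injOn (hΦ : h.IsArcFamily Φ) (hab : a ≠ b) : InjOn (Φ a b) (Icc 0 1) := by
  set Y := {y : K' × K' × ℝ × ℝ // y.1 ≠ y.2.1 ∧ y.2.2.1 ∈ Icc (0 : ℝ) 1 ∧
    y.2.2.2 ∈ Icc (0 : ℝ) 1 ∧ Φ y.1 y.2.1 y.2.2.1 = Φ y.1 y.2.1 y.2.2.2}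
  have aux : ∀ a b, h.idx a ≠ h.idx b → ∀ s ∈ Icc (0 : ℝ) 1, ∀ t ∈ Icc (0 : ℝ) 1, s < t →
      Φ a b s = Φ a b t →
      (∃ y : Y, t - s ≤ 2 / 3 * (y.1.2.2.2 - y.1.2.2.1)) ∨
        ∃ i j, i ≠ j ∧ ∃ s' ∈ Icc (0 : ℝ) 1, ∃ t' ∈ Icc (0 : ℝ) 1,
          Φ (h.vertex i) (h.vertex j) s' = Φ (h.vertex i) (h.vertex j) t' ∧
          t - s = (h.entryTime b - h.exitTime a) * (t' - s') := by
    intro a b hab s hs t ht hst heq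
    have hα0 := h.exitTime_nonneg a
    have hα := h.exitTime_le a
    have hβ := h.le_entryTime b
    have hβ1 := h.entryTime_le b
    rcases le_total t (h.exitTime a) with h1 | h1
    · left
      obtain ⟨hs', es⟩ := hΦ.eq_first hab hs.1 (hst.le.trans h1)
      obtain ⟨ht', et⟩ := hΦ.eq_first hab ht.1 h1
      have hz : h.shift a ≠ h.gluing (h.idx a) := fun hz => by
        rw [h.exitTime_eq_zero hz] at h1
        linarith [hs.1]
      refine ⟨⟨(_, _, _, _), hz, hs', ht', (h.sim (h.idx a)).injective ?_⟩, ?_⟩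
      · exact es.symm.trans (heq.trans et)
      · dsimp only
        rw [h.exitTime_eq hz]
        linarith
    rcases le_total (h.entryTime b) s with h2 | h2
    · left
      obtain ⟨hs', es⟩ := hΦ.eq_last hab h2 hs.2
      obtain ⟨ht', et⟩ := hΦ.eq_last hab (h2.trans hst.le) ht.2
      have hz : h.shift b ≠ h.gluing (h.idx b) := fun hz => by
        rw [h.entryTime_eq_one hz] at h2
        linarith [ht.2]
      refine ⟨⟨(_, _, _, _), Ne.symm hz, hs', ht', (h.sim (h.idx b)).injective ?_⟩, ?_⟩
      · exact es.symm.trans (heq.trans et)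
      · dsimp only
        rw [h.entryTime_eq hz, show (1 : ℝ) - 2 / 3 = 1 / 3 by norm_num]
        linarith
    rcases lt_or_ge s (h.exitTime a) with h3 | h3
    · exfalso
      obtain ⟨hs', es⟩ := hΦ.eq_first hab hs.1 h3.le
      rcases le_total t (h.entryTime b) with h4 | h4
      · obtain ⟨ht', et⟩ := hΦ.eq_middle hab h1 h4
        obtain ⟨e1, e2⟩ := h.eq_of_map₀_eq (hΦ.mem _ _ ht') (hΦ.mem _ _ hs')
          (et.symm.trans (heq.symm.trans es))
        have hz : h.shift a ≠ h.gluing (h.idx a) := fun hz => by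
          rw [h.exitTime_eq_zero hz] at h3
          linarith [hs.1]
        have := hΦ.eq_one_of_eq_right hz hs' e2
        rw [div_eq_one_iff_eq (by linarith [hs.1])] at this
        linarith
      · obtain ⟨ht', et⟩ := hΦ.eq_last hab h4 ht.2
        exact hab (h.eq_of_map_eq (hΦ.mem _ _ hs') (hΦ.mem _ _ ht')
          (es.symm.trans (heq.trans et)))
    · obtain ⟨hs', es⟩ := hΦ.eq_middle hab h3 h2
      rcases le_or_gt t (h.entryTime b) with h4 | h4
      · right
        obtain ⟨ht', et⟩ := hΦ.eq_middle hab h1 h4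
        refine ⟨_, _, hab, _, hs', _, ht', h.sim₀.injective ?_, ?_⟩
        · rw [← es, ← et, heq]
        · rw [← sub_div, mul_div_cancel₀ _ (by linarith)]
          ring
      · exfalso
        obtain ⟨ht', et⟩ := hΦ.eq_last hab h4.le ht.2
        obtain ⟨e1, e2⟩ := h.eq_of_map₀_eq (hΦ.mem _ _ hs') (hΦ.mem _ _ ht')
          (es.symm.trans (heq.trans et))
        have hz : h.shift b ≠ h.gluing (h.idx b) := fun hz => by
          rw [h.entryTime_eq_one hz] at h4
          linarith [ht.2]
        have := hΦ.eq_zero_of_eq_left (Ne.symm hz) ht' e2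
        rw [div_eq_zero_iff, h.entryTime_eq hz] at this
        rw [h.entryTime_eq hz] at h4
        rcases this with h5 | h5 <;> linarith
  have hstep : ∀ y : Y, ∃ y' : Y, y.1.2.2.2 - y.1.2.2.1 ≤ 2 / 3 * (y'.1.2.2.2 - y'.1.2.2.1) := by
    rintro ⟨⟨a, b, s, t⟩, hab, hs, ht, heq⟩
    dsimp only at hab hs ht heq ⊢
    rcases le_or_gt t s with hts | hst
    · exact ⟨⟨(a, b, s, s), hab, hs, hs, rfl⟩, by simpa using hts⟩
    obtain ⟨g, hg, a', b', hab', hgt⟩ := hΦ.exists_idx_ne hab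
    have heq' : Φ a' b' s = Φ a' b' t := hg (by rw [← hgt s hs, ← hgt t ht, heq])
    rcases aux a' b' hab' s hs t ht hst heq' with hy | ⟨i, j, hij, s', hs', t', ht', heq'', hle⟩
    · exact hy
    have h1 := h.exitTime_nonneg a'
    have h2 := h.exitTime_le a'
    have h3 := h.le_entryTime b'
    have h4 := h.entryTime_le b'
    have hst' : s' < t' := by
      by_contra! hts
      nlinarith
    have hle' : t - s ≤ t' - s' := by nlinarith
    have hij' : h.idx (h.vertex i) ≠ h.idx (h.vertex j) := by rwa [h.idx_vertex, h.idx_vertex]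
    rcases aux _ _ hij' s' hs' t' ht' hst' heq'' with
      ⟨y, hy⟩ | ⟨k, l, hkl, u, hu, v, hv, huv, hle''⟩
    · exact ⟨y, hle'.trans hy⟩
    -- On the path between two vertices the central piece takes only a third of the time.
    · rw [h.exitTime_eq (h.shift_vertex_ne i), h.entryTime_eq (h.shift_vertex_ne j)] at hle''
      exact ⟨⟨(_, _, u, v), fun e => hkl (h.vertex_injective e), hu, hv, huv⟩, by
        dsimp only
        linarith⟩
  have hY : ∀ y : Y, y.1.2.2.2 - y.1.2.2.1 ≤ 0 :=
    nonpos_of_forall_le_mul (ρ := 2 / 3) (M := 1) (by norm_num) (by norm_num)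
      (fun y : Y => y.1.2.2.2 - y.1.2.2.1)
      (fun y => by linarith [y.2.2.1.1, y.2.2.2.1.2]) hstep
  intro s hs t ht heq
  have h1 := hY ⟨(a, b, s, t), hab, hs, ht, heq⟩
  have h2 := hY ⟨(a, b, t, s), hab, ht, hs, heq.symm⟩
  dsimp only at h1 h2
  linarith

end IsArcFamily

end StarSystem

/-! ### Arcs and connected sets in general -/

/-- An arc has no proper connected subset containing both endpoints. -/
lemma IsArcIn.subset_of_isPreconnected {K γ D : Set ℂ} {x y : ℂ} (hγ : IsArcIn K x y γ)
    (hD : IsPreconnected D) (hDγ : D ⊆ γ) (hx : x ∈ D) (hy : y ∈ D) : γ ⊆ D := by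
  obtain ⟨-, f, hf, hinj, rfl, rfl, rfl⟩ := hγ
  set g : Icc (0 : ℝ) 1 → ℂ := (Icc 0 1).domRestrict f with hg
  have hemb : IsClosedEmbedding g :=
    (continuousOn_iff_continuous_domRestrict.1 hf).isClosedEmbedding (injOn_iff_injective.1 hinj)
  have himg : g '' (g ⁻¹' D) = D := by
    rw [image_preimage_eq_inter_range, hg, range_domRestrict]
    exact inter_eq_left.2 hDγ
  have hpre : IsPreconnected (g ⁻¹' D) := by
    rwa [← hemb.isInducing.isPreconnected_image, himg]
  have huniv : Icc (⟨0, by simp⟩ : Icc (0 : ℝ) 1) ⟨1, by simp⟩ ⊆ g ⁻¹' D :=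
    hpre.Icc_subset hx hy
  rintro - ⟨t, ht, rfl⟩
  exact huniv (show (⟨t, ht⟩ : Icc (0 : ℝ) 1) ∈ Icc _ _ from ⟨ht.1, ht.2⟩)

lemma IsArcIn.isSubcontinuum {K γ : Set ℂ} {x y : ℂ} (hγ : IsArcIn K x y γ) :
    IsSubcontinuum K γ := by
  obtain ⟨hK, f, hf, -, -, -, rfl⟩ := hγ
  exact ⟨hK, (isCompact_Icc.image_of_continuousOn hf).isClosed, isPreconnected_Icc.image f hf⟩

/-- The distance to one of the two points maps the set onto a set containing an interval. -/
lemma IsPreconnected.one_le_dimH {s : Set ℂ} (hs : IsPreconnected s) {x y : ℂ} (hx : x ∈ s)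
    (hy : y ∈ s) (hxy : x ≠ y) : 1 ≤ dimH s := by
  have hl : LipschitzWith 1 (fun z => dist z x) := LipschitzWith.dist_left x
  have hsub : Icc 0 (dist y x) ⊆ (fun z => dist z x) '' s :=
    (hs.image _ hl.continuous.continuousOn).Icc_subset ⟨x, hx, dist_self x⟩ ⟨y, hy, rfl⟩
  have hint : (interior (Icc 0 (dist y x))).Nonempty := by
    rw [interior_Icc]
    exact nonempty_Ioo.2 (dist_pos.2 hxy.symm)
  calc (1 : ℝ≥0∞) = dimH (Icc 0 (dist y x)) := by
        rw [Real.dimH_of_nonempty_interior hint, Module.finrank_self, Nat.cast_one]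
    _ ≤ dimH ((fun z => dist z x) '' s) := dimH_mono hsub
    _ ≤ dimH s := hl.dimH_image_le s

lemma IsSubcontinuum.union {K D E : Set ℂ} {x : ℂ} (hD : IsSubcontinuum K D)
    (hE : IsSubcontinuum K E) (hxD : x ∈ D) (hxE : x ∈ E) : IsSubcontinuum K (D ∪ E) :=
  ⟨union_subset hD.subset hE.subset, hD.isClosed.union hE.isClosed,
    hD.isPreconnected.union x hxD hxE hE.isPreconnected⟩

/-- The intersection of all subcontinua of `K` containing `x` and `y`. -/
def continuumHull (K : Set ℂ) (x y : ℂ) : Set ℂ :=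
  ⋂₀ {D | IsSubcontinuum K D ∧ x ∈ D ∧ y ∈ D}

/-- A subcontinuum contained in all others containing its two endpoints is the hull. -/
lemma continuumHull_eq {K E : Set ℂ} {x y : ℂ} (hE : IsSubcontinuum K E) (hx : x ∈ E) (hy : y ∈ E)
    (hmin : ∀ D, IsSubcontinuum K D → x ∈ D → y ∈ D → E ⊆ D) : continuumHull K x y = E :=
  Subset.antisymm (sInter_subset_of_mem ⟨hE, hx, hy⟩)
    (subset_sInter fun D hD => hmin D hD.1 hD.2.1 hD.2.2)

/-- If the hull of two points is an arc, it is the only arc joining them. -/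
lemma IsArcIn.eq_continuumHull {K γ : Set ℂ} {x y : ℂ}
    (hull : IsArcIn K x y (continuumHull K x y)) (hγ : IsArcIn K x y γ) :
    γ = continuumHull K x y := by
  have hx : x ∈ continuumHull K x y := mem_sInter.2 fun D hD => hD.2.1
  have hy : y ∈ continuumHull K x y := mem_sInter.2 fun D hD => hD.2.2
  have hxγ : x ∈ γ ∧ y ∈ γ := by
    obtain ⟨-, f, -, -, rfl, rfl, rfl⟩ := hγ
    exact ⟨⟨0, by simp, rfl⟩, ⟨1, by simp, rfl⟩⟩
  have hsub : continuumHull K x y ⊆ γ := sInter_subset_of_mem ⟨hγ.isSubcontinuum, hxγ⟩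
  exact Subset.antisymm
    (hγ.subset_of_isPreconnected hull.isSubcontinuum.isPreconnected hsub hx hy) hsub

namespace StarSystem

variable {S₀ : ℂ → ℂ} {S : Fin 3 → ℂ → ℂ} {A C : Fin 3 → ℂ} {K K' : Set ℂ} {ρ : ℝ}

/-! ### The branches from the centre to the vertices -/

lemma ne_vertex (h : StarSystem S₀ S A C K K' ρ) {O : ℂ} (hO : S₀ O = O) (i : Fin 3) :
    O ≠ A i := by
  rintro rfl
  exact h.A_ne_C i ((h.sim i).injective ((h.A_fixed i).trans (hO.symm.trans (h.glue i))))

namespace IsArcFamily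

variable {h : StarSystem S₀ S A C K K' ρ} {Φ : K' → K' → ℝ → ℂ} {a b : K'} {s t τ : ℝ} {O : ℂ}
  {i j : Fin 3}

lemma isSubcontinuum (hΦ : h.IsArcFamily Φ) (a b : K') {u v : ℝ} (hu : 0 ≤ u) (hv : v ≤ 1) :
    IsSubcontinuum K (Φ a b '' Icc u v) := by
  have hsub : Icc u v ⊆ Icc 0 1 := Icc_subset_Icc hu hv
  have hc := (hΦ.continuousOn a b).mono hsub
  refine ⟨?_, (isCompact_Icc.image_of_continuousOn hc).isClosed, isPreconnected_Icc.image _ hc⟩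
  rintro - ⟨t, ht, rfl⟩
  exact hΦ.mem a b (hsub ht)

lemma image_Icc_left_subset (hΦ : h.IsArcFamily Φ) (hab : a ≠ b) (hτ : τ ∈ Icc (0 : ℝ) 1)
    {D : Set ℂ} (hD : IsSubcontinuum K D) (hx : Φ a b τ ∈ D) (ha : (a : ℂ) ∈ D) :
    Φ a b '' Icc 0 τ ⊆ D := by
  rintro - ⟨t, ht, rfl⟩
  have hE := hD.union (hΦ.isSubcontinuum a b hτ.1 le_rfl) hx ⟨τ, ⟨le_rfl, hτ.2⟩, rfl⟩
  have ht1 : t ∈ Icc (0 : ℝ) 1 := ⟨ht.1, ht.2.trans hτ.2⟩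
  rcases hΦ.mem_subcontinuum hE (Or.inl ha) (Or.inr ⟨1, ⟨hτ.2, le_rfl⟩, hΦ.one a b⟩) ht1 with
    hmem | ⟨u, hu, hut⟩
  · exact hmem
  · have := hΦ.injOn hab ⟨hτ.1.trans hu.1, hu.2⟩ ht1 hut
    obtain rfl : t = τ := le_antisymm ht.2 (this ▸ hu.1)
    exact hx

lemma image_Icc_right_subset (hΦ : h.IsArcFamily Φ) (hab : a ≠ b) (hτ : τ ∈ Icc (0 : ℝ) 1)
    {D : Set ℂ} (hD : IsSubcontinuum K D) (hx : Φ a b τ ∈ D) (hb : (b : ℂ) ∈ D) :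
    Φ a b '' Icc τ 1 ⊆ D := by
  rintro - ⟨t, ht, rfl⟩
  have hE := hD.union (hΦ.isSubcontinuum a b le_rfl hτ.2) hx ⟨τ, ⟨hτ.1, le_rfl⟩, rfl⟩
  have ht1 : t ∈ Icc (0 : ℝ) 1 := ⟨hτ.1.trans ht.1, ht.2⟩
  rcases hΦ.mem_subcontinuum hE (Or.inr ⟨0, ⟨le_rfl, hτ.1⟩, hΦ.zero a b⟩) (Or.inl hb) ht1 with
    hmem | ⟨u, hu, hut⟩
  · exact hmem
  · have := hΦ.injOn hab ⟨hu.1, hu.2.trans hτ.2⟩ ht1 hut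
    obtain rfl : t = τ := le_antisymm (this ▸ hu.2) ht.1
    exact hx

lemma vertex_ne (h : StarSystem S₀ S A C K K' ρ) (hij : i ≠ j) : h.vertex i ≠ h.vertex j :=
  fun e => hij (h.vertex_injective e)

/-- The path between two vertices passes through the fixed point of the central map, since the
central map sends the path into itself. -/
lemma exists_eq_center (hΦ : h.IsArcFamily Φ) (hO : S₀ O = O) (hij : i ≠ j) :
    ∃ τ ∈ Ioo (0 : ℝ) 1, Φ (h.vertex i) (h.vertex j) τ = O := by
  have hmem : O ∈ Φ (h.vertex i) (h.vertex j) '' Icc 0 1 := by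
    refine h.sim₀.mem_of_fixed h.lt_one (hΦ.isSubcontinuum _ _ le_rfl le_rfl).isClosed
      ⟨_, 0, by simp, rfl⟩ ?_ hO
    rintro - ⟨t, ht, rfl⟩
    have hij' : h.idx (h.vertex i) ≠ h.idx (h.vertex j) := by rwa [h.idx_vertex, h.idx_vertex]
    have e1 := h.exitTime_eq (h.shift_vertex_ne i)
    have e2 := h.entryTime_eq (h.shift_vertex_ne j)
    refine ⟨1 / 3 + t / 3, ⟨by linarith [ht.1], by linarith [ht.2]⟩, ?_⟩
    rw [(hΦ.eq_middle (t := 1 / 3 + t / 3) hij' (by rw [e1]; linarith [ht.1])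
      (by rw [e2]; linarith [ht.2])).2, h.idx_vertex, h.idx_vertex, e1, e2]
    congr 2
    ring
  obtain ⟨τ, hτ, rfl⟩ := hmem
  refine ⟨τ, ⟨hτ.1.lt_of_ne ?_, hτ.2.lt_of_ne ?_⟩, rfl⟩
  · rintro rfl
    exact h.ne_vertex hO i (hΦ.zero _ _)
  · rintro rfl
    exact h.ne_vertex hO j (hΦ.one _ _)

lemma image_Icc_left_eq_hull (hΦ : h.IsArcFamily Φ) (hij : i ≠ j) (hτ : τ ∈ Icc (0 : ℝ) 1)
    (hτO : Φ (h.vertex i) (h.vertex j) τ = O) :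
    continuumHull K O (A i) = Φ (h.vertex i) (h.vertex j) '' Icc 0 τ :=
  continuumHull_eq (hΦ.isSubcontinuum _ _ le_rfl hτ.2) ⟨τ, ⟨hτ.1, le_rfl⟩, hτO⟩
    ⟨0, ⟨le_rfl, hτ.1⟩, hΦ.zero _ _⟩ fun _ hD hO hA =>
      hΦ.image_Icc_left_subset (vertex_ne h hij) hτ hD (hτO ▸ hO) hA

lemma image_Icc_right_eq_hull (hΦ : h.IsArcFamily Φ) (hij : i ≠ j) (hτ : τ ∈ Icc (0 : ℝ) 1)
    (hτO : Φ (h.vertex i) (h.vertex j) τ = O) :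
    continuumHull K O (A j) = Φ (h.vertex i) (h.vertex j) '' Icc τ 1 :=
  continuumHull_eq (hΦ.isSubcontinuum _ _ hτ.1 le_rfl) ⟨τ, ⟨le_rfl, hτ.2⟩, hτO⟩
    ⟨1, ⟨hτ.2, le_rfl⟩, hΦ.one _ _⟩ fun _ hD hO hA =>
      hΦ.image_Icc_right_subset (vertex_ne h hij) hτ hD (hτO ▸ hO) hA

lemma mem_hull_union_hull (hΦ : h.IsArcFamily Φ) (hO : S₀ O = O) (hij : i ≠ j)
    (ht : t ∈ Icc (0 : ℝ) 1) : Φ (h.vertex i) (h.vertex j) t ∈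
      continuumHull K O (A i) ∪ continuumHull K O (A j) := by
  obtain ⟨τ, hτ, hτO⟩ := hΦ.exists_eq_center hO hij
  rw [hΦ.image_Icc_left_eq_hull hij (Ioo_subset_Icc_self hτ) hτO,
    hΦ.image_Icc_right_eq_hull hij (Ioo_subset_Icc_self hτ) hτO]
  exact (le_total t τ).imp (fun hle => ⟨t, ⟨ht.1, hle⟩, rfl⟩) fun hle => ⟨t, ⟨hle, ht.2⟩, rfl⟩

lemma isArcIn_hull (hΦ : h.IsArcFamily Φ) (hO : S₀ O = O) (i : Fin 3) :
    IsArcIn K O (A i) (continuumHull K O (A i)) := by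
  have hij : i ≠ i + 1 := by revert i; decide
  obtain ⟨τ, hτ, hτO⟩ := hΦ.exists_eq_center hO hij
  rw [hΦ.image_Icc_left_eq_hull hij (Ioo_subset_Icc_self hτ) hτO]
  have hmaps : MapsTo (fun t : ℝ => τ * (1 - t)) (Icc 0 1) (Icc 0 τ) := fun t ht =>
    ⟨mul_nonneg hτ.1.le (by linarith [ht.2]), by nlinarith [hτ.1, ht.1]⟩
  have hsub : Icc 0 τ ⊆ Icc 0 1 := Icc_subset_Icc le_rfl hτ.2.le
  refine ⟨(hΦ.isSubcontinuum _ _ le_rfl hτ.2.le).subset,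
    fun t => Φ (h.vertex i) (h.vertex (i + 1)) (τ * (1 - t)), ?_, ?_, ?_, ?_, ?_⟩
  · exact (hΦ.continuousOn _ _).comp (by fun_prop) fun t ht => hsub (hmaps ht)
  · intro s hs t ht hst
    have := hΦ.injOn (vertex_ne h hij) (hsub (hmaps hs)) (hsub (hmaps ht)) hst
    have := mul_left_cancel₀ hτ.1.ne' this
    linarith
  · simpa using hτO
  · simp only [sub_self, mul_zero]
    exact hΦ.zero _ _
  · apply Subset.antisymm
    · rintro - ⟨t, ht, rfl⟩
      exact ⟨_, hmaps ht, rfl⟩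
    · rintro - ⟨t, ht, rfl⟩
      refine ⟨1 - t / τ, ⟨?_, ?_⟩, ?_⟩
      · linarith [div_le_one_of_le₀ ht.2 hτ.1.le]
      · linarith [div_nonneg ht.1 hτ.1.le]
      · dsimp only
        rw [sub_sub_cancel, mul_div_cancel₀ _ hτ.1.ne']

/-- The branch to `A i` must cross the central piece of `S i K` from the gluing point of the
piece `i` to that of the piece `i + 1`, which holds `C i`. Hence it contains a copy of the next
branch. -/
lemma image_hull_subset (hΦ : h.IsArcFamily Φ) (hO : S₀ O = O) (i : Fin 3) :
    (S i ∘ S₀) '' continuumHull K O (A (i + 1)) ⊆ continuumHull K O (A i) := by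
  have hij : i + 1 ≠ i := by revert i; decide
  obtain ⟨τ, hτ, hτO⟩ := hΦ.exists_eq_center hO hij
  rw [hΦ.image_Icc_left_eq_hull hij (Ioo_subset_Icc_self hτ) hτO]
  rintro - ⟨-, ⟨t, ht, rfl⟩, rfl⟩
  have hOK : O ∈ K := hτO ▸ hΦ.mem _ _ (Ioo_subset_Icc_self hτ)
  have hAK : ∀ k, A k ∈ K := fun k => h.subset (h.A_mem k)
  have hAS : ∀ k, A k ∈ S k '' K := fun k => ⟨A k, hAK k, h.A_fixed k⟩
  rw [continuumHull, mem_sInter]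
  rintro D ⟨hD, hOD, hAD⟩
  have hB : S₀ (A i) ∈ D := h.glue_mem hD hAD (hAS i) hOD (Or.inl ⟨O, hOK, hO⟩)
  have hD' := h.pull hD i
  have hA' : A i ∈ K ∩ S i ⁻¹' D := ⟨hAK i, by rwa [mem_preimage, h.A_fixed]⟩
  have hC' : C i ∈ K ∩ S i ⁻¹' D := ⟨h.subset (h.C_mem' i), by rwa [mem_preimage, ← h.glue]⟩
  have hCS : C i ∈ S (i + 1) '' K := image_mono h.subset (h.C_mem i)
  have hB1 := h.glue_mem hD' hA' (hAS i) hC' (image_subset_rest hij hCS)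
  have hB2 := h.glue_mem hD' hC' hCS hA' (image_subset_rest hij.symm (hAS i))
  exact (hΦ.mem_subcontinuum (a := h.vertex (i + 1)) (b := h.vertex i) (h.pull₀ hD')
    ⟨hAK _, hB2⟩ ⟨hAK _, hB1⟩ ⟨ht.1, ht.2.trans hτ.2.le⟩).2.2

lemma dimH_hull_eq (hΦ : h.IsArcFamily Φ) (hO : S₀ O = O) (i : Fin 3) :
    dimH (continuumHull K O (A i)) = dimH (continuumHull K O (A 0)) := by
  have hle : ∀ i, dimH (continuumHull K O (A (i + 1))) ≤ dimH (continuumHull K O (A i)) := by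
    intro i
    refine (h.sim₀.le_dimH_of_image_subset Subset.rfl).trans
      ((h.sim i).le_dimH_of_image_subset ?_)
    rw [← image_comp]
    exact hΦ.image_hull_subset hO i
  have h0 : dimH (continuumHull K O (A 1)) ≤ dimH (continuumHull K O (A 0)) := hle 0
  have h1 : dimH (continuumHull K O (A 2)) ≤ dimH (continuumHull K O (A 1)) := hle 1
  have h2 : dimH (continuumHull K O (A 0)) ≤ dimH (continuumHull K O (A 2)) := hle 2
  fin_cases i
  · rfl
  · exact le_antisymm h0 (h2.trans h1)
  · exact le_antisymm (h1.trans h0) h2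

end IsArcFamily

/-! ### Connectedness and local connectedness of `K` -/

/-- Replacing the pieces of `K` by the images of connected sets containing `K'` gives again a
connected set containing `K'`, because `K'` contains all the vertices and gluing points. -/
lemma isPreconnected_pieces (h : StarSystem S₀ S A C K K' ρ) {E₀ : Set ℂ} {E : Fin 3 → Set ℂ}
    (h₀ : IsPreconnected E₀) (hE : ∀ k, IsPreconnected (E k)) (h₀' : K' ⊆ E₀)
    (hE' : ∀ k, K' ⊆ E k) :
    IsPreconnected (S₀ '' E₀ ∪ ⋃ k, S k '' E k) ∧ K' ⊆ S₀ '' E₀ ∪ ⋃ k, S k '' E k := by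
  refine ⟨isPreconnected_star (b := fun k => S₀ (A k)) (h₀.image _ h.sim₀.continuous.continuousOn)
    (fun k => (hE k).image _ (h.sim k).continuous.continuousOn)
    (fun k => ⟨A k, h₀' (h.A_mem k), rfl⟩) fun k => ⟨C k, hE' k (h.C_mem' k), (h.glue k).symm⟩, ?_⟩
  refine h.eq_union'.subset.trans (Subset.trans ?_ subset_union_right)
  exact iUnion_mono fun k => image_mono (hE' k)

namespace IsArcFamily

variable {h : StarSystem S₀ S A C K K' ρ} {Φ : K' → K' → ℝ → ℂ} {a b : K'} {s t τ : ℝ} {O : ℂ}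

/-- The union of the paths from a vertex to the points of `K'`. -/
def skeleton (h : StarSystem S₀ S A C K K' ρ) (Φ : K' → K' → ℝ → ℂ) : Set ℂ :=
  ⋃ b, Φ (h.vertex 0) b '' Icc 0 1

lemma isPreconnected_skeleton (hΦ : h.IsArcFamily Φ) : IsPreconnected (skeleton h Φ) :=
  isPreconnected_iUnion ⟨A 0, mem_iInter.2 fun b => ⟨0, by simp, hΦ.zero _ _⟩⟩ fun b =>
    (hΦ.isSubcontinuum _ b le_rfl le_rfl).isPreconnected

lemma subset_skeleton (hΦ : h.IsArcFamily Φ) : K' ⊆ skeleton h Φ := fun x hx =>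
  mem_iUnion.2 ⟨⟨x, hx⟩, 1, by simp, hΦ.one _ _⟩

lemma skeleton_subset (hΦ : h.IsArcFamily Φ) : skeleton h Φ ⊆ K :=
  iUnion_subset fun b => (hΦ.isSubcontinuum _ b le_rfl le_rfl).subset

/-- `K` is the closure of the union of the connected sets obtained from the skeleton by
applying the maps of the system. -/
lemma isPreconnected (hΦ : h.IsArcFamily Φ) : IsPreconnected K := by
  set T : Set ℂ → Set ℂ := fun N => S₀ '' N ∪ ⋃ k, S k '' N with hT
  set N : ℕ → Set ℂ := fun n => T^[n] (skeleton h Φ) with hN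
  have hsucc : ∀ n, N (n + 1) = T (N n) := fun n => Function.iterate_succ_apply' _ _ _
  have hconn : ∀ n, IsPreconnected (N n) ∧ K' ⊆ N n := by
    intro n
    induction n with
    | zero => exact ⟨hΦ.isPreconnected_skeleton, hΦ.subset_skeleton⟩
    | succ n ih =>
      rw [hsucc]
      exact h.isPreconnected_pieces ih.1 (fun _ => ih.1) ih.2 fun _ => ih.2
  have hsub : ∀ n, N n ⊆ K := by
    intro n
    induction n with
    | zero => exact hΦ.skeleton_subset
    | succ n ih =>
      rw [hsucc, h.eq_union]
      exact union_subset_union (image_mono ih) (iUnion_mono fun k => image_mono ih)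
  obtain ⟨M, hM⟩ := Metric.isBounded_iff.1 h.isCompact.isBounded
  have hclose : ∀ n, ∀ x ∈ K, ∃ y ∈ N n, dist x y ≤ ρ ^ n * M := by
    intro n
    induction n with
    | zero =>
      intro x hx
      have hA := (hconn 0).2 (h.A_mem 0)
      exact ⟨A 0, hA, by simpa using hM hx (hsub 0 hA)⟩
    | succ n ih =>
      intro x hx
      have hf : ∀ f, IsSimilarityLE ρ f → (∀ y ∈ N n, f y ∈ N (n + 1)) → ∀ z ∈ K, f z = x →
          ∃ y ∈ N (n + 1), dist x y ≤ ρ ^ (n + 1) * M := by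
        rintro f hf hfN z hz rfl
        obtain ⟨y, hy, hzy⟩ := ih z hz
        refine ⟨f y, hfN y hy, (hf.dist_le z y).trans ?_⟩
        rw [pow_succ', mul_assoc]
        exact mul_le_mul_of_nonneg_left hzy h.pos.le
      rcases h.cases hx with ⟨z, hz, hzx⟩ | ⟨k, z, hz, hzx⟩
      · exact hf S₀ h.sim₀ (fun y hy => hsucc n ▸ Or.inl ⟨y, hy, rfl⟩) z hz hzx
      · exact hf (S k) (h.sim k) (fun y hy => hsucc n ▸ Or.inr (mem_iUnion.2 ⟨k, y, hy, rfl⟩))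
          z hz hzx
  have hunion : IsPreconnected (⋃ n, N n) :=
    isPreconnected_iUnion ⟨A 0, mem_iInter.2 fun n => (hconn n).2 (h.A_mem 0)⟩ fun n => (hconn n).1
  refine hunion.subset_closure (iUnion_subset hsub) fun x hx => ?_
  rw [Metric.mem_closure_iff]
  intro ε hε
  obtain ⟨n, hn⟩ := h.exists_pow_mul_lt M hε
  obtain ⟨y, hy, hxy⟩ := hclose n x hx
  exact ⟨y, mem_iUnion.2 ⟨n, hy⟩, hxy.trans_lt hn⟩

/-- `K` is a finite union of arbitrarily small subcontinua, its pieces of level `n`. -/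
lemma exists_finite_cover (hΦ : h.IsArcFamily Φ) : ∃ M, ∀ n : ℕ, ∃ F : Set (Set ℂ), F.Finite ∧
    (∀ E ∈ F, IsSubcontinuum K E ∧ ∀ u ∈ E, ∀ v ∈ E, dist u v ≤ ρ ^ n * M) ∧ K ⊆ ⋃₀ F := by
  obtain ⟨M, hM⟩ := Metric.isBounded_iff.1 h.isCompact.isBounded
  refine ⟨M, fun n => ?_⟩
  induction n with
  | zero =>
    refine ⟨{K}, finite_singleton K, ?_, (sUnion_singleton K).ge⟩
    rintro E rfl
    exact ⟨⟨Subset.rfl, h.isCompact.isClosed, hΦ.isPreconnected⟩, fun u hu v hv => by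
      simpa using hM hu hv⟩
  | succ n ih =>
    obtain ⟨F, hF, hFE, hFK⟩ := ih
    have hf : ∀ f, IsSimilarityLE ρ f → (∀ y ∈ K, f y ∈ K) → ∀ E ∈ F,
        IsSubcontinuum K (f '' E) ∧ ∀ u ∈ f '' E, ∀ v ∈ f '' E, dist u v ≤ ρ ^ (n + 1) * M := by
      intro f hf hfK E hE
      obtain ⟨hEK, hEd⟩ := hFE E hE
      refine ⟨⟨?_, ?_, hEK.isPreconnected.image f hf.continuous.continuousOn⟩, ?_⟩
      · rintro - ⟨y, hy, rfl⟩
        exact hfK y (hEK.subset hy)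
      · exact ((h.isCompact.of_isClosed_subset hEK.isClosed hEK.subset).image
          hf.continuous).isClosed
      · rintro - ⟨u, hu, rfl⟩ - ⟨v, hv, rfl⟩
        rw [pow_succ', mul_assoc]
        exact (hf.dist_le u v).trans (mul_le_mul_of_nonneg_left (hEd u hu v hv) h.pos.le)
    refine ⟨(S₀ '' ·) '' F ∪ ⋃ k, (S k '' ·) '' F,
      (hF.image _).union (finite_iUnion fun k => hF.image _), ?_, ?_⟩
    · rintro E (⟨E, hE, rfl⟩ | hE)
      · exact hf S₀ h.sim₀ (fun y => h.map₀_mem) E hE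
      · obtain ⟨k, E, hEF, rfl⟩ := mem_iUnion.1 hE
        exact hf (S k) (h.sim k) (fun y => h.map_mem k) E hEF
    · intro x hx
      rcases h.cases hx with ⟨z, hz, rfl⟩ | ⟨k, z, hz, rfl⟩
      · obtain ⟨E, hE, hzE⟩ := hFK hz
        exact ⟨_, Or.inl ⟨E, hE, rfl⟩, z, hzE, rfl⟩
      · obtain ⟨E, hE, hzE⟩ := hFK hz
        exact ⟨_, Or.inr (mem_iUnion.2 ⟨k, E, hE, rfl⟩), z, hzE, rfl⟩

/-- If `K \ {x}` is connected, any two of its points lie in a subcontinuum of `K` avoiding `x`. -/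
lemma exists_isSubcontinuum (hΦ : h.IsArcFamily Φ) {x y z : ℂ}
    (hx : IsPreconnected (K \ {x})) (hy : y ∈ K \ {x}) (hz : z ∈ K \ {x}) :
    ∃ D, IsSubcontinuum K D ∧ x ∉ D ∧ y ∈ D ∧ z ∈ D := by
  obtain ⟨M, hM⟩ := hΦ.exists_finite_cover
  refine hx.induction₂ (fun y z => ∃ D, IsSubcontinuum K D ∧ x ∉ D ∧ y ∈ D ∧ z ∈ D) ?_ ?_ ?_ hy hz
  · intro y hy
    obtain ⟨n, hn⟩ := h.exists_pow_mul_lt M (dist_pos.2 hy.2)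
    obtain ⟨F, hF, hFE, hFK⟩ := hM n
    -- Near `y` only those pieces are met which contain `y`.
    have hev : ∀ᶠ z in 𝓝[K \ {x}] y, ∀ E ∈ F, z ∈ E → y ∈ E := by
      rw [eventually_all_finite hF]
      intro E hE
      by_cases hyE : y ∈ E
      · exact Eventually.of_forall fun _ _ => hyE
      · have hEc := (hFE E hE).1.isClosed.isOpen_compl.mem_nhds hyE
        filter_upwards [mem_nhdsWithin_of_mem_nhds hEc] with z hz hzE using absurd hzE hz
    filter_upwards [hev, self_mem_nhdsWithin] with z hz hzK
    obtain ⟨E, hE, hzE⟩ := hFK hzK.1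
    have hyE := hz E hE hzE
    exact ⟨E, (hFE E hE).1, fun hxE => ((hFE E hE).2 y hyE x hxE).not_gt hn, hyE, hzE⟩
  · rintro u v w hu hv hw ⟨D, hD, hxD, huD, hvD⟩ ⟨E, hE, hxE, hvE, hwE⟩
    exact ⟨D ∪ E, hD.union hE hvD hvE, fun hxDE => hxDE.elim hxD hxE, Or.inl huD, Or.inr hwE⟩
  · rintro u v hu hv ⟨D, hD, hxD, huD, hvD⟩
    exact ⟨D, hD, hxD, hvD, huD⟩

/-! ### Cut points -/

/-- The interior points of the paths are cut points of `K`. -/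
lemma mem_cutPoints (hΦ : h.IsArcFamily Φ) (hab : a ≠ b) (ht : t ∈ Ioo (0 : ℝ) 1) :
    Φ a b t ∈ cutPoints K := by
  have ht' := Ioo_subset_Icc_self ht
  refine ⟨hΦ.mem a b ht', fun hx => ?_⟩
  have ha : (a : ℂ) ∈ K \ {Φ a b t} := ⟨h.coe_mem a, fun e =>
    ht.1.ne' (hΦ.eq_zero_of_eq_left hab ht' e.symm)⟩
  have hb : (b : ℂ) ∈ K \ {Φ a b t} := ⟨h.coe_mem b, fun e =>
    ht.2.ne (hΦ.eq_one_of_eq_right hab ht' e.symm)⟩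
  obtain ⟨D, hD, hxD, haD, hbD⟩ := hΦ.exists_isSubcontinuum hx ha hb
  exact hxD (hΦ.mem_subcontinuum hD haD hbD ht')

lemma dimH_hull_le (hΦ : h.IsArcFamily Φ) (hO : S₀ O = O) :
    dimH (continuumHull K O (A 0)) ≤ dimH (cutPoints K) := by
  have hij : (0 : Fin 3) ≠ 1 := by decide
  obtain ⟨τ, hτ, hτO⟩ := hΦ.exists_eq_center hO hij
  rw [hΦ.image_Icc_left_eq_hull hij (Ioo_subset_Icc_self hτ) hτO]
  have hsub : Φ (h.vertex 0) (h.vertex 1) '' Icc 0 τ ⊆ cutPoints K ∪ {A 0} := by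
    rintro - ⟨t, ht, rfl⟩
    rcases ht.1.eq_or_lt with rfl | h0
    · exact Or.inr (hΦ.zero _ _)
    · exact Or.inl (hΦ.mem_cutPoints (vertex_ne h hij) ⟨h0, ht.2.trans_lt hτ.2⟩)
  refine (dimH_mono hsub).trans ?_
  rw [dimH_union, dimH_singleton]
  exact max_le le_rfl zero_le

variable {X : Set ℂ}

/-- A set `X` invariant under the maps of the system, containing `K'` and the images under `S₀` of
the paths between the vertices, contains all the paths: a point outside of it would have only
indices of outer maps in its address, hence would lie in `K'`. -/
lemma mem_of_invariant (hΦ : h.IsArcFamily Φ) (hX : ∀ k, ∀ x ∈ X, S k x ∈ X) (hK' : K' ⊆ X)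
    (hv : ∀ i j, i ≠ j → ∀ t ∈ Icc (0 : ℝ) 1, S₀ (Φ (h.vertex i) (h.vertex j) t) ∈ X)
    (ht : t ∈ Icc (0 : ℝ) 1) : Φ a b t ∈ X := by
  by_contra hX'
  obtain ⟨M, hM⟩ := hΦ.exists_infDist_le
  have hne : K'.Nonempty := ⟨_, h.A_mem 0⟩
  have := nonpos_of_forall_le_mul (Y := {y : K' × K' × ℝ // y.2.2 ∈ Icc (0 : ℝ) 1 ∧
      Φ y.1 y.2.1 y.2.2 ∉ X}) h.pos.le
    h.lt_one (fun y => Metric.infDist (Φ y.1.1 y.1.2.1 y.1.2.2) K')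
    (fun y => hM K' h.subset hne _ _ _ y.2.1) ?_ ⟨(a, b, t), ht, hX'⟩
  · refine hX' (hK' ?_)
    rw [h.isCompact'.isClosed.mem_iff_infDist_zero hne]
    exact le_antisymm this Metric.infDist_nonneg
  · rintro ⟨⟨a, b, t⟩, ht, hX'⟩
    dsimp only at ht hX' ⊢
    have hk : ∀ k a' b', ∀ t' ∈ Icc (0 : ℝ) 1, Φ a b t = S k (Φ a' b' t') →
        ∃ y' : {y : K' × K' × ℝ // y.2.2 ∈ Icc (0 : ℝ) 1 ∧ Φ y.1 y.2.1 y.2.2 ∉ X},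
          Metric.infDist (Φ a b t) K' ≤ ρ * Metric.infDist (Φ y'.1.1 y'.1.2.1 y'.1.2.2) K' := by
      intro k a' b' t' ht' heq
      refine ⟨⟨(a', b', t'), ht', fun hmem => hX' (heq ▸ hX k _ hmem)⟩, ?_⟩
      refine (congrArg (Metric.infDist · K') heq).le.trans ?_
      exact (h.sim k).infDist_le hne (fun y => h.map_mem' k) _
    by_cases hab : h.idx a = h.idx b
    · exact hk _ _ _ t ht (hΦ.eq_same hab ht)
    rcases le_total t (h.exitTime a) with h1 | h1
    · obtain ⟨ht', heq⟩ := hΦ.eq_first hab ht.1 h1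
      exact hk _ _ _ _ ht' heq
    rcases le_total t (h.entryTime b) with h2 | h2
    · obtain ⟨ht', heq⟩ := hΦ.eq_middle hab h1 h2
      exact absurd (heq ▸ hv _ _ hab _ ht') hX'
    · obtain ⟨ht', heq⟩ := hΦ.eq_last hab h2 ht.2
      exact hk _ _ _ _ ht' heq

/-- If `x` is not in an invariant set containing the skeleton, the pieces of level `n` containing
`x` can be replaced by copies of the skeleton, which leaves a connected set avoiding `x`. -/
lemma cutPoints_subset (hΦ : h.IsArcFamily Φ) (hX₀ : ∀ x ∈ X, S₀ x ∈ X)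
    (hX : ∀ k, ∀ x ∈ X, S k x ∈ X) (hK' : K' ⊆ X)
    (hv : ∀ i j, i ≠ j → ∀ t ∈ Icc (0 : ℝ) 1, S₀ (Φ (h.vertex i) (h.vertex j) t) ∈ X) :
    cutPoints K ⊆ X := by
  rintro x ⟨hxK, hcut⟩
  by_contra hxX
  apply hcut
  obtain ⟨M, hM⟩ := Metric.isBounded_iff.1 h.isCompact.isBounded
  have hsub : skeleton h Φ ⊆ X := by
    refine iUnion_subset fun b => ?_
    rintro - ⟨t, ht, rfl⟩
    exact hΦ.mem_of_invariant hX hK' hv ht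
  have hglue : ∀ k, S₀ (A k) ∈ X := fun k => hX₀ _ (hK' (h.A_mem k))
  have key : ∀ n : ℕ, ∀ x ∈ K \ X, ∃ D ⊆ K \ {x}, IsPreconnected D ∧ K' ⊆ D ∧
      ∀ y ∈ K, ρ ^ n * M < dist x y → y ∈ D := by
    intro n
    induction n with
    | zero =>
      rintro x ⟨hxK, hxX⟩
      refine ⟨skeleton h Φ, fun y hy => ⟨hΦ.skeleton_subset hy, fun e => hxX (e ▸ hsub hy)⟩,
        hΦ.isPreconnected_skeleton, hΦ.subset_skeleton, fun y hy hlt => ?_⟩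
      rw [pow_zero, one_mul] at hlt
      exact absurd (hM hxK hy) hlt.not_ge
    | succ n ih =>
      rintro x ⟨hxK, hxX⟩
      have hlt' : ∀ f, IsSimilarityLE ρ f → ∀ u v, ρ ^ (n + 1) * M < dist (f u) (f v) →
          ρ ^ n * M < dist u v := by
        intro f hf u v huv
        rw [pow_succ', mul_assoc] at huv
        exact lt_of_mul_lt_mul_left (huv.trans_le (hf.dist_le u v)) h.pos.le
      rcases h.cases hxK with ⟨z, hz, rfl⟩ | ⟨i, z, hz, rfl⟩
      · obtain ⟨D, hD, hDc, hDK', hDy⟩ := ih z ⟨hz, fun hzX => hxX (hX₀ z hzX)⟩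
        obtain ⟨hc, hc'⟩ := h.isPreconnected_pieces hDc (fun _ => hΦ.isPreconnected) hDK'
          fun _ => h.subset
        refine ⟨_, ?_, hc, hc', fun y hy hlt => ?_⟩
        · rintro y (⟨w, hw, rfl⟩ | hy)
          · exact ⟨h.map₀_mem (hD hw).1, fun e => (hD hw).2 (h.sim₀.injective e)⟩
          · obtain ⟨k, w, hw, rfl⟩ := mem_iUnion.1 hy
            refine ⟨h.map_mem k hw, fun e => hxX ?_⟩
            rw [(h.eq_of_map₀_eq hz hw (Eq.symm e)).1]
            exact hglue k
        · rcases h.cases hy with ⟨w, hw, rfl⟩ | ⟨k, w, hw, rfl⟩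
          · exact Or.inl ⟨w, hDy w hw (hlt' S₀ h.sim₀ z w hlt), rfl⟩
          · exact Or.inr (mem_iUnion.2 ⟨k, w, hw, rfl⟩)
      · obtain ⟨D, hD, hDc, hDK', hDy⟩ := ih z ⟨hz, fun hzX => hxX (hX i z hzX)⟩
        obtain ⟨hc, hc'⟩ := h.isPreconnected_pieces (E := fun k => if k = i then D else K)
          hΦ.isPreconnected (fun k => by
            split_ifs
            exacts [hDc, hΦ.isPreconnected]) h.subset fun k => by
            split_ifs
            exacts [hDK', h.subset]
        refine ⟨_, ?_, hc, hc', fun y hy hlt => ?_⟩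
        · rintro y (⟨w, hw, rfl⟩ | hy)
          · refine ⟨h.map₀_mem hw, fun e => hxX ?_⟩
            rw [← show S₀ w = S i z from e, (h.eq_of_map₀_eq hw hz e).1]
            exact hglue i
          · obtain ⟨k, w, hw, rfl⟩ := mem_iUnion.1 hy
            by_cases hki : k = i
            · subst hki
              rw [if_pos rfl] at hw
              exact ⟨h.map_mem k (hD hw).1, fun e => (hD hw).2 ((h.sim k).injective e)⟩
            · rw [if_neg hki] at hw
              exact ⟨h.map_mem k hw, fun e => hki (h.eq_of_map_eq hw hz e)⟩
        · rcases h.cases hy with ⟨w, hw, rfl⟩ | ⟨k, w, hw, rfl⟩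
          · exact Or.inl ⟨w, hw, rfl⟩
          · refine Or.inr (mem_iUnion.2 ⟨k, w, ?_, rfl⟩)
            by_cases hki : k = i
            · subst hki
              rw [if_pos rfl]
              exact hDy w hw (hlt' (S k) (h.sim k) z w hlt)
            · rwa [if_neg hki]
  refine isPreconnected_of_forall_pair fun y hy z hz => ?_
  have hpos : 0 < min (dist x y) (dist x z) :=
    lt_min (dist_pos.2 (Ne.symm hy.2)) (dist_pos.2 (Ne.symm hz.2))
  obtain ⟨n, hn⟩ := h.exists_pow_mul_lt M hpos
  obtain ⟨D, hD, hDc, -, hDy⟩ := key n x ⟨hxK, hxX⟩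
  exact ⟨D, hD, hDy y hy.1 (hn.trans_le (min_le_left _ _)),
    hDy z hz.1 (hn.trans_le (min_le_right _ _)), hDc⟩

end IsArcFamily

end StarSystem

/-! ### Attractors -/

lemma IsAttractor.map_mem {ι : Type*} {S : ι → ℂ → ℂ} {K : Set ℂ} (hK : IsAttractor S K) (i : ι)
    {x : ℂ} (hx : x ∈ K) : S i x ∈ K := by
  rw [hK.2.2]
  exact mem_iUnion.2 ⟨i, x, hx, rfl⟩

lemma IsAttractor.subset_of_forall_mem {ι : Type*} {S : ι → ℂ → ℂ} {K T : Set ℂ} {ρ : ℝ}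
    (hK : IsAttractor S K) (hρ : 0 ≤ ρ) (hρ1 : ρ < 1) (hS : ∀ i, IsSimilarityLE ρ (S i))
    (hT : IsClosed T) (hne : T.Nonempty) (hST : ∀ i, ∀ x ∈ T, S i x ∈ T) : K ⊆ T := by
  intro x hx
  obtain ⟨M, hM⟩ := hK.2.1.bddAbove_image (f := fun x => Metric.infDist x T)
    (Metric.continuous_infDist_pt T).continuousOn
  rw [hT.mem_iff_infDist_zero hne]
  refine le_antisymm (nonpos_of_forall_le_mul hρ hρ1 (fun y : K => Metric.infDist (y : ℂ) T)
    (fun y => hM ⟨y, y.2, rfl⟩) ?_ ⟨x, hx⟩) Metric.infDist_nonneg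
  rintro ⟨y, hy⟩
  rw [hK.2.2] at hy
  obtain ⟨i, z, hz, rfl⟩ := mem_iUnion.1 hy
  exact ⟨⟨z, hz⟩, (hS i).infDist_le hne (hST i) z⟩

lemma exists_lipschitzWith_wordMap {ι : Type*} {S : ι → ℂ → ℂ} {c : ι → NNReal}
    (hS : ∀ i, LipschitzWith (c i) (S i)) (w : List ι) :
    LipschitzWith (w.map c).prod (wordMap S w) := by
  induction w with
  | nil => exact LipschitzWith.id
  | cons i w ih =>
    rw [List.map_cons, List.prod_cons]
    exact (hS i).comp ih

lemma IsAttractor.subset_iUnion_wordMap {ι : Type*} {S : ι → ℂ → ℂ} {K : Set ℂ}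
    (hK : IsAttractor S K) (n : ℕ) :
    K ⊆ ⋃ w : Fin n → ι, wordMap S (List.ofFn w) '' K := by
  induction n with
  | zero => exact fun x hx => mem_iUnion.2 ⟨Fin.elim0, x, hx, rfl⟩
  | succ n ih =>
    intro x hx
    rw [hK.2.2] at hx
    obtain ⟨i, y, hy, rfl⟩ := mem_iUnion.1 hx
    obtain ⟨w, z, hz, rfl⟩ := mem_iUnion.1 (ih hy)
    refine mem_iUnion.2 ⟨Fin.cons i w, z, hz, ?_⟩
    rw [List.ofFn_cons]
    rfl

/-- If the contraction ratios of a finite system have sum `< 1`, the covers of the attractor by its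
pieces of level `n` show that its one-dimensional Hausdorff measure is finite. -/
lemma IsAttractor.dimH_le_one {ι : Type*} [Fintype ι] {S : ι → ℂ → ℂ} {K : Set ℂ}
    (hK : IsAttractor S K) {c : ι → NNReal} (hS : ∀ i, LipschitzWith (c i) (S i))
    (hc : ∑ i, c i < 1) : dimH K ≤ 1 := by
  have hfin : Metric.ediam K ≠ ⊤ := hK.2.1.isBounded.ediam_ne_top
  have hdiam : ∀ n, ∀ w : Fin n → ι, Metric.ediam (wordMap S (List.ofFn w) '' K) ≤
      ((∏ i, c (w i) : NNReal) : ℝ≥0∞) * Metric.ediam K := by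
    intro n w
    have := (exists_lipschitzWith_wordMap hS (List.ofFn w)).ediam_image_le K
    rwa [List.map_ofFn, List.prod_ofFn] at this
  have hsum : ∀ n : ℕ, ∑ w : Fin n → ι, ∏ i, c (w i) = (∑ i, c i) ^ n := fun n =>
    (Fintype.sum_pow c n).symm
  have hle : MeasureTheory.Measure.hausdorffMeasure 1 K ≤ Metric.ediam K := by
    refine (MeasureTheory.Measure.hausdorffMeasure_le_liminf_sum 1 K (l := atTop)
      (ι := fun n : ℕ => Fin n → ι)
      (fun n : ℕ => (((∑ i, c i) ^ n : NNReal) : ℝ≥0∞) * Metric.ediam K) ?_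
      (fun n w => wordMap S (List.ofFn w) '' K) (Eventually.of_forall fun n w => ?_)
      (Eventually.of_forall fun n => hK.subset_iUnion_wordMap n)).trans ?_
    · have h0 : Tendsto (fun n : ℕ => (((∑ i, c i) ^ n : NNReal) : ℝ≥0∞)) atTop (𝓝 0) := by
        simp only [ENNReal.coe_pow]
        exact ENNReal.tendsto_pow_atTop_nhds_zero_of_lt_one (by exact_mod_cast hc)
      simpa using ENNReal.Tendsto.mul_const h0 (Or.inr hfin)
    · refine (hdiam n w).trans ?_
      gcongr
      rw [← hsum]
      exact Finset.single_le_sum (f := fun w : Fin n → ι => ∏ i, c (w i))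
        (fun _ _ => zero_le) (Finset.mem_univ w)
    · refine liminf_le_of_le (by isBoundedDefault) fun b hb => ?_
      obtain ⟨n, hn⟩ := hb.exists
      refine hn.trans ?_
      simp only [ENNReal.rpow_one]
      refine (Finset.sum_le_sum fun w _ => hdiam n w).trans ?_
      rw [← Finset.sum_mul, ← ENNReal.ofNNReal_finsetSum, hsum]
      refine mul_le_of_le_one_left' ?_
      exact_mod_cast pow_le_one₀ zero_le hc.le
  have := dimH_le_of_hausdorffMeasure_ne_top (s := K) (d := 1)
    (by rw [NNReal.coe_one]; exact (hle.trans_lt hfin.lt_top).ne)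
  simpa using this

lemma map_mem_semigroupOrbit {ι : Type*} {S : ι → ℂ → ℂ} {X : Set ℂ} (i : ι) {x : ℂ}
    (hx : x ∈ semigroupOrbit S X) : S i x ∈ semigroupOrbit S X := by
  obtain ⟨w, hw, y, hy, rfl⟩ := mem_iUnion₂.1 hx
  exact mem_iUnion₂.2 ⟨i :: w, List.cons_ne_nil _ _, y, hy, rfl⟩

lemma map_mem_semigroupOrbit_of_mem {ι : Type*} {S : ι → ℂ → ℂ} {X : Set ℂ} (i : ι) {x : ℂ}
    (hx : x ∈ X) : S i x ∈ semigroupOrbit S X :=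
  mem_iUnion₂.2 ⟨[i], List.cons_ne_nil _ _, x, hx, rfl⟩

lemma dimH_semigroupOrbit_le {ι : Type*} [Countable ι] {S : ι → ℂ → ℂ} {c : ι → NNReal}
    (hS : ∀ i, LipschitzWith (c i) (S i)) (X : Set ℂ) : dimH (semigroupOrbit S X) ≤ dimH X := by
  rw [semigroupOrbit, dimH_bUnion (to_countable _)]
  exact iSup₂_le fun w _ => (exists_lipschitzWith_wordMap hS w).dimH_image_le X

/-! ### Barycentric coordinates -/

/-- The barycentric coordinates with respect to the triangle with vertices `triVertex k`. -/
noncomputable def bary (k : Fin 3) (z : ℂ) : ℝ :=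
  ![1 - z.re - z.im / √3, z.re - z.im / √3, 2 * z.im / √3] k

lemma bary_sum (z : ℂ) : bary 0 z + bary 1 z + bary 2 z = 1 := by
  simp only [bary, Matrix.cons_val]
  ring

lemma continuous_bary (k : Fin 3) : Continuous (bary k) := by
  unfold bary
  fin_cases k <;> dsimp <;> fun_prop

lemma bary_triVertex (j k : Fin 3) : bary j (triVertex k) = if j = k then 1 else 0 := by
  have h3 : √3 ≠ 0 := by positivity
  fin_cases j <;> fin_cases k <;> simp [bary, triVertex] <;> field_simp <;> norm_num

lemma bary_combination (j : Fin 3) (w₀ w₁ w₂ : ℝ) (hw : w₀ + w₁ + w₂ = 1) (x y z : ℂ) :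
    bary j (w₀ * x + w₁ * y + w₂ * z) = w₀ * bary j x + w₁ * bary j y + w₂ * bary j z := by
  obtain rfl : w₀ = 1 - w₁ - w₂ := by linarith
  fin_cases j <;> simp [bary] <;> ring

lemma eq_bary_combination (z : ℂ) :
    z = bary 0 z * triVertex 0 + bary 1 z * triVertex 1 + bary 2 z * triVertex 2 := by
  have h3 : √3 ≠ 0 := by positivity
  apply Complex.ext
  · simp [bary, triVertex]
    ring
  · simp [bary, triVertex]
    field_simp

lemma eq_of_bary_eq {z w : ℂ} (h : ∀ k, bary k z = bary k w) : z = w := by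
  rw [eq_bary_combination z, eq_bary_combination w, h, h, h]

lemma bary_cornerMap (p : Fin 3 → ℝ) (j k : Fin 3) (z : ℂ) :
    bary j (cornerMap p k z) = p k * bary j z + (1 - p k) * if j = k then 1 else 0 := by
  have := bary_combination j (p k) (1 - p k) 0 (by ring) z (triVertex k) 0
  rw [bary_triVertex, zero_mul, add_zero] at this
  rw [← this, cornerMap]
  congr 1
  push_cast
  ring

lemma dist_eq_bary (z w : ℂ) : dist z w ^ 2 = (bary 1 z - bary 1 w) ^ 2 +
    (bary 1 z - bary 1 w) * (bary 2 z - bary 2 w) + (bary 2 z - bary 2 w) ^ 2 := by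
  have h3 : √3 ^ 2 = 3 := Real.sq_sqrt (by norm_num)
  have h3' : √3 ≠ 0 := by positivity
  rw [Complex.dist_eq, Complex.sq_norm, Complex.normSq_apply]
  simp only [bary, Matrix.cons_val, Complex.sub_re, Complex.sub_im]
  field_simp
  ring_nf
  simp only [h3]
  ring

lemma dist_lt_one_of_bary {z w : ℂ} (h : ∀ k, |bary k z - bary k w| < 1) : dist z w < 1 := by
  have h0 := abs_lt.1 (h 0)
  have h1 := abs_lt.1 (h 1)
  have h2 := abs_lt.1 (h 2)
  have hz := bary_sum z
  have hw := bary_sum w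
  rw [← sq_lt_one_iff₀ dist_nonneg, dist_eq_bary]
  set x := bary 1 z - bary 1 w with hx
  set y := bary 2 z - bary 2 w with hy
  have h0l : x + y < 1 := by linarith
  have h0r : -1 < x + y := by linarith
  -- With `v = -x - y` the quadratic form equals `x ^ 2 - y * v`, and similarly for the other two
  -- variables; it remains to single out a variable such that the other two have the same sign.
  rcases le_total 0 x with hx0 | hx0 <;> rcases le_total 0 y with hy0 | hy0 <;>
    rcases le_total 0 (x + y) with hxy | hxy <;> nlinarith

lemma dist_cornerMap (p : Fin 3 → ℝ) (hp : ∀ k, 0 < p k) (k : Fin 3) (x y : ℂ) :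
    dist (cornerMap p k x) (cornerMap p k y) = p k * dist x y := by
  rw [dist_eq_norm, dist_eq_norm, cornerMap, cornerMap,
    show (p k : ℂ) * x - p k * triVertex k + triVertex k - (p k * y - p k * triVertex k +
      triVertex k) = p k * (x - y) by ring, norm_mul, Complex.norm_real,
    Real.norm_of_nonneg (hp k).le]

/-- A dilation of the plane is affine, so it preserves barycentric coordinates. -/
lemma Dilation.bary_apply (f : ℂ →ᵈ ℂ) (j : Fin 3) (z : ℂ) :
    bary j (f z) = bary 0 z * bary j (f (triVertex 0)) + bary 1 z * bary j (f (triVertex 1)) +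
      bary 2 z * bary j (f (triVertex 2)) := by
  obtain ⟨r, hr⟩ : ∃ r : ℝ, r = (Dilation.ratio f : NNReal) := ⟨_, rfl⟩
  have hr0 : 0 < r := hr ▸ Dilation.ratio_pos f
  have hiso : Isometry fun z => r⁻¹ • f z := by
    refine Isometry.of_dist_eq fun x y => ?_
    rw [dist_smul₀, Dilation.dist_eq, Real.norm_of_nonneg (inv_nonneg.2 hr0.le), ← hr,
      inv_mul_cancel_left₀ hr0.ne']
  set g := hiso.affineIsometryOfStrictConvexSpace with hg
  have hfg : ∀ z, f z = r • (g.linear z + g 0) := by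
    intro z
    have h1 : g z = g.linear z + g 0 := congrFun (AffineMap.decomp g.toAffineMap) z
    have h2 : g z = r⁻¹ • f z := rfl
    rw [← h1, h2, smul_inv_smul₀ hr0.ne']
  rw [← bary_combination j _ _ _ (bary_sum z)]
  congr 1
  have hs := bary_sum z
  obtain ⟨u, hu⟩ : ∃ u, bary 0 z = u := ⟨_, rfl⟩
  obtain ⟨v, hv⟩ : ∃ v, bary 1 z = v := ⟨_, rfl⟩
  obtain ⟨w, hw⟩ : ∃ w, bary 2 z = w := ⟨_, rfl⟩
  have hz := eq_bary_combination z
  rw [hu, hv, hw] at hs hz ⊢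
  simp only [← Complex.real_smul] at hz ⊢
  conv_lhs => rw [hz]
  simp only [hfg, map_add, map_smul]
  obtain rfl : u = 1 - v - w := by linarith
  module

/-! ### The triangle system is a star system -/

/-- The closed triangle with vertices `triVertex k`. -/
def closedTriangle : Set ℂ := {z | ∀ k, 0 ≤ bary k z}

lemma isClosed_closedTriangle : IsClosed closedTriangle := by
  simp only [closedTriangle, ofPred_forall]
  exact isClosed_iInter fun k => isClosed_le continuous_const (continuous_bary k)

lemma triVertex_mem_closedTriangle (k : Fin 3) : triVertex k ∈ closedTriangle := fun j => by
  rw [bary_triVertex]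
  split_ifs <;> norm_num

lemma bary_le_one {z : ℂ} (hz : z ∈ closedTriangle) (k : Fin 3) : bary k z ≤ 1 := by
  have := bary_sum z
  have h0 := hz 0
  have h1 := hz 1
  have h2 := hz 2
  fin_cases k <;> simp only [Fin.zero_eta, Fin.mk_one, Fin.reduceFinMk] <;> linarith

section CornerMaps

variable {p : Fin 3 → ℝ}

lemma lt_one_of_sum_lt_one (hp : ∀ k, 0 < p k) (hp_sum : p 0 + p 1 + p 2 < 1) (k : Fin 3) :
    p k < 1 := by
  have h0 := hp 0
  have h1 := hp 1
  have h2 := hp 2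
  fin_cases k <;> simp only [Fin.zero_eta, Fin.mk_one, Fin.reduceFinMk] <;> linarith

lemma add_lt_one_of_sum_lt_one (hp : ∀ k, 0 < p k) (hp_sum : p 0 + p 1 + p 2 < 1) {i j : Fin 3}
    (hij : i ≠ j) : p i + p j < 1 := by
  have h0 := hp 0
  have h1 := hp 1
  have h2 := hp 2
  fin_cases i <;> fin_cases j <;> first | exact absurd rfl hij | skip
  all_goals
    simp only [Fin.zero_eta, Fin.mk_one, Fin.reduceFinMk]
    linarith

lemma isSimilarityLE_cornerMap (hp : ∀ k, 0 < p k) {ρ : ℝ} (hρ : ∀ k, p k ≤ ρ) (k : Fin 3) :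
    IsSimilarityLE ρ (cornerMap p k) :=
  ⟨p k, hp k, hρ k, dist_cornerMap p hp k⟩

lemma cornerMap_triVertex (p : Fin 3 → ℝ) (k : Fin 3) :
    cornerMap p k (triVertex k) = triVertex k := by
  rw [cornerMap, sub_self, zero_add]

lemma bary_cornerMap_self (p : Fin 3 → ℝ) (k : Fin 3) (z : ℂ) :
    bary k (cornerMap p k z) = p k * bary k z + (1 - p k) := by
  rw [bary_cornerMap, if_pos rfl, mul_one]

lemma bary_cornerMap_of_ne (p : Fin 3 → ℝ) {j k : Fin 3} (hjk : j ≠ k) (z : ℂ) :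
    bary j (cornerMap p k z) = p k * bary j z := by
  rw [bary_cornerMap, if_neg hjk, mul_zero, add_zero]

lemma cornerMap_mem_closedTriangle (hp : ∀ k, 0 < p k) (hp_sum : p 0 + p 1 + p 2 < 1) (k : Fin 3)
    {z : ℂ} (hz : z ∈ closedTriangle) : cornerMap p k z ∈ closedTriangle := fun j => by
  have h1 := lt_one_of_sum_lt_one hp hp_sum k
  have h2 := mul_nonneg (hp k).le (hz j)
  rw [bary_cornerMap]
  split_ifs <;> linarith

/-- A point of the `j`-th corner has large `j`-th coordinate, so it lies in no other corner. -/
lemma eq_of_le_bary_cornerMap (hp : ∀ k, 0 < p k) (hp_sum : p 0 + p 1 + p 2 < 1) {i j : Fin 3}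
    {z : ℂ} (hz : z ∈ closedTriangle) (h : 1 - p i ≤ bary i (cornerMap p j z)) : i = j := by
  by_contra hij
  rw [bary_cornerMap_of_ne p hij] at h
  have h1 := add_lt_one_of_sum_lt_one hp hp_sum hij
  have h2 := mul_le_mul_of_nonneg_left (bary_le_one hz i) (hp j).le
  linarith

lemma le_bary_cornerMap (hp : ∀ k, 0 < p k) {k : Fin 3} {z : ℂ} (hz : z ∈ closedTriangle) :
    1 - p k ≤ bary k (cornerMap p k z) := by
  rw [bary_cornerMap_self]
  linarith [mul_nonneg (hp k).le (hz k)]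

lemma subset_closedTriangle (hp : ∀ k, 0 < p k) (hp_sum : p 0 + p 1 + p 2 < 1)
    {K' : Set ℂ} (hK' : IsAttractor (cornerMap p) K') : K' ⊆ closedTriangle := by
  have h0 := hp 0
  have h1 := hp 1
  have h2 := hp 2
  refine hK'.subset_of_forall_mem (ρ := p 0 + p 1 + p 2) (by linarith) hp_sum
    (isSimilarityLE_cornerMap hp fun k => ?_) isClosed_closedTriangle
    ⟨_, triVertex_mem_closedTriangle 0⟩
    fun k z hz => cornerMap_mem_closedTriangle hp hp_sum k hz
  fin_cases k <;> simp only [Fin.zero_eta, Fin.mk_one, Fin.reduceFinMk] <;> linarith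

/-- A point of `K'` on the side of `S k S (k + 1) Δ` where the `k`-th coordinate is minimal is the
image under `S k` of a point of `S (k + 1) K'`. -/
lemma exists_gluing_point (hp : ∀ k, 0 < p k) (hp_sum : p 0 + p 1 + p 2 < 1)
    {K' : Set ℂ} (hK' : IsAttractor (cornerMap p) K') {k l m : Fin 3} (hl : l ≠ k) (hm : m ≠ k)
    {b : ℂ}
    (hb : b ∈ K' ∩ (cornerMap p k ∘ cornerMap p (k + 1)) ''
      segment ℝ (triVertex l) (triVertex m)) :
    ∃ c ∈ cornerMap p (k + 1) '' K', b = cornerMap p k c ∧ bary k c = 0 := by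
  have hT := subset_closedTriangle hp hp_sum hK'
  obtain ⟨hbK, u, ⟨α, β, hα, hβ, hαβ, rfl⟩, rfl⟩ := hb
  have hkk : k ≠ k + 1 := (by decide : ∀ i : Fin 3, i ≠ i + 1) k
  set u := α • triVertex l + β • triVertex m with hu
  have hbu : ∀ j, bary j u = α * (if j = l then 1 else 0) + β * if j = m then 1 else 0 := by
    intro j
    have := bary_combination j α β 0 (by linarith) (triVertex l) (triVertex m) 0
    rw [zero_mul, add_zero, bary_triVertex, bary_triVertex] at this
    rw [← this, hu, Complex.real_smul, Complex.real_smul]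
    congr 1
    push_cast
    ring
  have huT : u ∈ closedTriangle := fun j => by
    rw [hbu]
    split_ifs <;> linarith
  have hu0 : bary k u = 0 := by
    rw [hbu, if_neg hl.symm, if_neg hm.symm]
    ring
  have hc0 : bary k (cornerMap p (k + 1) u) = 0 := by
    rw [bary_cornerMap_of_ne p hkk, hu0, mul_zero]
  have hinj : Function.Injective (cornerMap p k) :=
    (isSimilarityLE_cornerMap hp (fun j => (lt_one_of_sum_lt_one hp hp_sum j).le) k).injective
  have hvK : cornerMap p (k + 1) u ∈ K' := by
    have hbK' := hbK
    rw [hK'.2.2] at hbK'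
    obtain ⟨j, v, hv, hvb⟩ := mem_iUnion.1 hbK'
    obtain rfl : k = j := eq_of_le_bary_cornerMap hp hp_sum (hT hv) (by
      rw [hvb]
      exact le_bary_cornerMap hp (cornerMap_mem_closedTriangle hp hp_sum _ huT))
    rwa [← hinj hvb]
  refine ⟨cornerMap p (k + 1) u, ?_, rfl, hc0⟩
  have hvK' := hvK
  rw [hK'.2.2] at hvK'
  obtain ⟨j, v, hv, hvb⟩ := mem_iUnion.1 hvK'
  obtain rfl : k + 1 = j := eq_of_le_bary_cornerMap hp hp_sum (hT hv) (by
    rw [hvb]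
    exact le_bary_cornerMap hp huT)
  exact ⟨v, hv, hvb⟩

end CornerMaps

lemma iUnion_dendriteSystem (p : Fin 3 → ℝ) (S₀ : ℂ → ℂ) (X : Set ℂ) :
    ⋃ i, dendriteSystem p S₀ i '' X = S₀ '' X ∪ ⋃ k, cornerMap p k '' X := by
  ext x
  simp only [mem_iUnion, mem_union, Fin.exists_fin_succ (n := 3)]
  refine or_congr Iff.rfl (exists_congr fun k => ?_)
  fin_cases k <;> rfl

lemma dendriteSystem_succ (p : Fin 3 → ℝ) (S₀ : ℂ → ℂ) (k : Fin 3) :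
    dendriteSystem p S₀ k.succ = cornerMap p k := by
  fin_cases k <;> rfl

/-- The inscribed triangle `S₀ Δ` lies in `Δ`, touches the corner `S k Δ` only at `S₀ (A k)`, and is
strictly smaller than `Δ`. -/
lemma exists_starSystem {p : Fin 3 → ℝ} (hp : ∀ k, 0 < p k) (hp_sum : p 0 + p 1 + p 2 < 1)
    {K' : Set ℂ} (hK' : IsAttractor (cornerMap p) K') {S₀ : ℂ →ᵈ ℂ} {C : Fin 3 → ℂ}
    (hC : ∀ k, C k ∈ cornerMap p (k + 1) '' K') (hC₀ : ∀ k, bary k (C k) = 0)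
    (hS₀ : ∀ k, S₀ (triVertex k) = cornerMap p k (C k)) {K : Set ℂ}
    (hK : IsAttractor (dendriteSystem p S₀) K) :
    ∃ ρ, StarSystem S₀ (cornerMap p) triVertex C K K' ρ := by
  have hT' := subset_closedTriangle hp hp_sum hK'
  have hCT : ∀ k, C k ∈ closedTriangle := fun k => by
    obtain ⟨v, hv, hvC⟩ := hC k
    exact hvC ▸ hT' (hK'.map_mem _ hv)
  have hBT : ∀ k, S₀ (triVertex k) ∈ closedTriangle := fun k => by
    rw [hS₀]
    exact cornerMap_mem_closedTriangle hp hp_sum k (hCT k)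
  have hBself : ∀ k, bary k (S₀ (triVertex k)) = 1 - p k := fun k => by
    rw [hS₀, bary_cornerMap_self, hC₀, mul_zero, zero_add]
  have hBne : ∀ j k, j ≠ k → bary j (S₀ (triVertex k)) < 1 - p j := fun j k hjk => by
    rw [hS₀, bary_cornerMap_of_ne p hjk]
    have h1 := add_lt_one_of_sum_lt_one hp hp_sum hjk
    have h2 := mul_le_mul_of_nonneg_left (bary_le_one (hCT k) j) (hp k).le
    linarith
  have hBlt : ∀ j k, bary j (S₀ (triVertex k)) < 1 := fun j k => by
    by_cases hjk : j = k
    · rw [hjk, hBself]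
      linarith [hp k]
    · linarith [hBne j k hjk, hp j]
  have hST : ∀ z ∈ closedTriangle, S₀ z ∈ closedTriangle := fun z hz j => by
    rw [Dilation.bary_apply]
    have := fun k => mul_nonneg (hz k) (hBT k j)
    linarith [this 0, this 1, this 2]
  obtain ⟨r, hr⟩ : ∃ r : ℝ, r = (Dilation.ratio S₀ : NNReal) := ⟨_, rfl⟩
  have hr0 : 0 < r := hr ▸ Dilation.ratio_pos S₀
  have hrd : ∀ x y, dist (S₀ x) (S₀ y) = r * dist x y := fun x y => by
    rw [hr]
    exact Dilation.dist_eq S₀ x y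
  have hr1 : r < 1 := by
    have h1 : dist (S₀ (triVertex 0)) (S₀ (triVertex 1)) = r := by
      rw [hrd]
      simp [triVertex]
    rw [← h1]
    refine dist_lt_one_of_bary fun k => abs_lt.2 ⟨?_, ?_⟩
    · linarith [hBlt k 1, hBT 0 k]
    · linarith [hBlt k 0, hBT 1 k]
  have hp0 := hp 0
  have hp1 := hp 1
  have hp2 := hp 2
  set ρ : ℝ := max r (p 0 + p 1 + p 2) with hρ
  have hρ1 : ρ < 1 := max_lt hr1 hp_sum
  have hsim₀ : IsSimilarityLE ρ S₀ := ⟨r, hr0, le_max_left _ _, hrd⟩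
  have hsim : ∀ k, IsSimilarityLE ρ (cornerMap p k) := isSimilarityLE_cornerMap hp fun k => by
    refine le_trans ?_ (le_max_right _ _)
    fin_cases k <;> simp only [Fin.zero_eta, Fin.mk_one, Fin.reduceFinMk] <;> linarith
  have hK_eq : K = S₀ '' K ∪ ⋃ k, cornerMap p k '' K := by
    rw [← iUnion_dendriteSystem]
    exact hK.2.2
  have hKT : K ⊆ closedTriangle := by
    refine hK.subset_of_forall_mem hsim₀.pos.le hρ1 ?_ isClosed_closedTriangle
      ⟨_, triVertex_mem_closedTriangle 0⟩ ?_
    · refine Fin.cases hsim₀ fun k => ?_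
      rw [dendriteSystem_succ]
      exact hsim k
    · refine Fin.cases hST fun k => ?_
      rw [dendriteSystem_succ]
      exact fun z hz => cornerMap_mem_closedTriangle hp hp_sum k hz
  have hsub : K' ⊆ K := by
    refine hK'.subset_of_forall_mem hsim₀.pos.le hρ1 hsim hK.2.1.isClosed hK.1 fun k z hz => ?_
    rw [← dendriteSystem_succ p S₀]
    exact hK.map_mem k.succ hz
  refine ⟨ρ, hρ1, hsim₀, hsim, hK.2.1, hK_eq, hK'.2.1, hK'.2.2, hsub, fun k => ?_,
    cornerMap_triVertex p, hC, hS₀, fun k => ?_, fun i j hij => ?_⟩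
  · exact (hsim k).mem_of_fixed hρ1 hK'.2.1.isClosed hK'.1 (fun y hy => hK'.map_mem k hy)
      (cornerMap_triVertex p k)
  · rintro - ⟨⟨y, hy, rfl⟩, z, hz, hzy⟩
    have h1 : 1 - p k ≤ bary k (S₀ y) := hzy ▸ le_bary_cornerMap hp (hKT hz)
    have hyT := hKT hy
    have hsum := bary_sum y
    -- The `k`-th coordinate of `S₀ y` is a convex combination of numbers `≤ 1 - p k`, where only
    -- the one belonging to the vertex `k` attains this value.
    have hprod : ∀ j, 0 ≤ bary j y * (1 - p k - bary k (S₀ (triVertex j))) := fun j => by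
      by_cases hj : j = k
      · rw [hj, hBself, sub_self, mul_zero]
      · exact mul_nonneg (hyT j) (by linarith [hBne k j (Ne.symm hj)])
    rw [Dilation.bary_apply] at h1
    have hzero : ∀ j, bary j y * (1 - p k - bary k (S₀ (triVertex j))) = 0 := by
      have e : bary 0 y * (1 - p k - bary k (S₀ (triVertex 0))) +
          bary 1 y * (1 - p k - bary k (S₀ (triVertex 1))) +
          bary 2 y * (1 - p k - bary k (S₀ (triVertex 2))) ≤ 0 := by
        have : (bary 0 y + bary 1 y + bary 2 y) * (1 - p k) = 1 - p k := by rw [hsum, one_mul]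
        linarith
      have e0 := hprod 0
      have e1 := hprod 1
      have e2 := hprod 2
      intro j
      fin_cases j <;> simp only [Fin.zero_eta, Fin.mk_one, Fin.reduceFinMk] <;> linarith
    have hyj : ∀ j, j ≠ k → bary j y = 0 := fun j hj =>
      (mul_eq_zero.1 (hzero j)).resolve_right (by linarith [hBne k j hj.symm])
    have hyk : bary k y = 1 := by
      fin_cases k
      · change bary 0 y = 1
        linarith [hyj 1 (by decide), hyj 2 (by decide)]
      · change bary 1 y = 1
        linarith [hyj 0 (by decide), hyj 2 (by decide)]
      · change bary 2 y = 1
        linarith [hyj 0 (by decide), hyj 1 (by decide)]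
    have : y = triVertex k := eq_of_bary_eq fun j => by
      rw [bary_triVertex]
      split_ifs with hj
      · rw [hj, hyk]
      · exact hyj j hj
    rw [this]
    rfl
  · rw [Set.disjoint_left]
    rintro - ⟨y, hy, rfl⟩ ⟨z, hz, hzy⟩
    exact hij (eq_of_le_bary_cornerMap hp hp_sum (hKT hz)
      (hzy ▸ le_bary_cornerMap hp (hKT hy)))

theorem theorem5
    (p : Fin 3 → ℝ) (hp : ∀ k, 0 < p k) (hp_sum : p 0 + p 1 + p 2 < 1)
    (K' : Set ℂ) (hK' : IsAttractor (cornerMap p) K')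
    (B : Fin 3 → ℂ)
    (hB₁ : B 0 ∈ K' ∩
      (cornerMap p 0 ∘ cornerMap p 1) '' segment ℝ (triVertex 1) (triVertex 2))
    (hB₂ : B 1 ∈ K' ∩
      (cornerMap p 1 ∘ cornerMap p 2) '' segment ℝ (triVertex 0) (triVertex 2))
    (hB₃ : B 2 ∈ K' ∩
      (cornerMap p 2 ∘ cornerMap p 0) '' segment ℝ (triVertex 0) (triVertex 1))
    (S₀ : ℂ →ᵈ ℂ) (hS₀ : ∀ k, S₀ (triVertex k) = B k)
    (O : ℂ) (hO : S₀ O = O)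
    (K : Set ℂ) (hK : IsAttractor (dendriteSystem p S₀) K) :
    ∃ (γ : Fin 3 → Set ℂ) (s : ℝ≥0∞),
      (∀ k, IsArcIn K O (triVertex k) (γ k) ∧
        ∀ γ' : Set ℂ, IsArcIn K O (triVertex k) γ' → γ' = γ k) ∧
      (∀ k, dimH (γ k) = s) ∧
      dimH (cutPoints K) = s ∧
      cutPoints K ⊆ semigroupOrbit (dendriteSystem p S₀) ((⋃ k, γ k) ∪ K') ∧
      dimH K' ≤ 1 := by
  have hB : ∀ k, ∃ c ∈ cornerMap p (k + 1) '' K', B k = cornerMap p k c ∧ bary k c = 0 := by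
    intro k
    fin_cases k
    · exact exists_gluing_point hp hp_sum hK' (k := 0) (l := 1) (m := 2) (by decide) (by decide)
        hB₁
    · exact exists_gluing_point hp hp_sum hK' (k := 1) (l := 0) (m := 2) (by decide) (by decide)
        hB₂
    · exact exists_gluing_point hp hp_sum hK' (k := 2) (l := 0) (m := 1) (by decide) (by decide)
        hB₃
  choose C hC hBC hC₀ using hB
  obtain ⟨ρ, h⟩ := exists_starSystem hp hp_sum hK' hC hC₀ (fun k => (hS₀ k).trans (hBC k)) hK
  obtain ⟨Φ, hΦ⟩ := h.exists_isArcFamily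
  have harc := fun k => hΦ.isArcIn_hull hO k
  have hdim := fun k => hΦ.dimH_hull_eq hO k
  have hdimK' : dimH K' ≤ 1 := by
    refine hK'.dimH_le_one (c := fun k => (p k).toNNReal)
      (fun k => LipschitzWith.of_dist_le_mul fun x y => ?_) ?_
    · rw [Real.coe_toNNReal _ (hp k).le]
      exact (dist_cornerMap p hp k x y).le
    · rw [← NNReal.coe_lt_coe, NNReal.coe_sum, Fin.sum_univ_three, Real.coe_toNNReal _ (hp 0).le,
        Real.coe_toNNReal _ (hp 1).le, Real.coe_toNNReal _ (hp 2).le]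
      exact hp_sum
  have hone : 1 ≤ dimH (continuumHull K O (triVertex 0)) :=
    (harc 0).isSubcontinuum.isPreconnected.one_le_dimH (mem_sInter.2 fun D hD => hD.2.1)
      (mem_sInter.2 fun D hD => hD.2.2) (h.ne_vertex hO 0)
  set X := semigroupOrbit (dendriteSystem p S₀) ((⋃ k, continuumHull K O (triVertex k)) ∪ K')
    with hX
  have hXk : ∀ k, ∀ x ∈ X, cornerMap p k x ∈ X := fun k x hx => by
    rw [← dendriteSystem_succ p S₀]
    exact map_mem_semigroupOrbit k.succ hx
  have hcut : cutPoints K ⊆ X := by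
    refine hΦ.cutPoints_subset (fun x hx => map_mem_semigroupOrbit (S := dendriteSystem p S₀) 0 hx)
      hXk ?_ fun i j hij t ht => ?_
    · intro x hx
      rw [h.eq_union'] at hx
      obtain ⟨k, y, hy, rfl⟩ := mem_iUnion.1 hx
      rw [← dendriteSystem_succ p S₀]
      exact map_mem_semigroupOrbit_of_mem k.succ (Or.inr hy)
    · refine map_mem_semigroupOrbit_of_mem (S := dendriteSystem p S₀) 0 (Or.inl ?_)
      exact (hΦ.mem_hull_union_hull hO hij ht).elim (fun hm => mem_iUnion.2 ⟨i, hm⟩)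
        fun hm => mem_iUnion.2 ⟨j, hm⟩
  refine ⟨fun k => continuumHull K O (triVertex k), dimH (continuumHull K O (triVertex 0)),
    fun k => ⟨harc k, fun γ' hγ' => (harc k).eq_continuumHull hγ'⟩, hdim, ?_, hcut, hdimK'⟩
  refine le_antisymm ?_ (hΦ.dimH_hull_le hO)
  have hlip : ∀ i, LipschitzWith ρ.toNNReal (dendriteSystem p S₀ i) := by
    refine Fin.cases h.sim₀.lipschitzWith fun k => ?_
    rw [dendriteSystem_succ]
    exact (h.sim k).lipschitzWith
  refine (dimH_mono hcut).trans ((dimH_semigroupOrbit_le hlip _).trans ?_)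
  rw [dimH_union, dimH_iUnion]
  exact max_le (iSup_le fun k => (hdim k).le) (hdimK'.trans hone)
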